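/- Let $n\ge 2$ and $m\ge n+1$ be integers. There is a constant $C$, depending only on $n$ and $m$, such that the following holds. Let $f\in W^{1,n}(\mathbb S^n,\mathbb R^m)\cap C^0(\mathbb S^n,\mathbb R^m)$ and let $g\in C^\infty(\mathbb S^n,\mathbb R^m)$, where $\mathbb S^n$ is the unit sphere of $\mathbb R^{n+1}$ with its surface measure $\sigma$. Then there is a function $$H\in C^0(\mathbb S^n\times[0,1],\mathbb R^m)\cap C^\infty(\mathbb S^n\times[0,1),\mathbb R^m)$$ (smooth up to the boundary part $\mathbb S^n\times\{0\}$) such that $H(x,0)=g(x)$ and $H(x,1)=f(x)$ for all $x\in\mathbb S^n$, and $$ \mathcal H^{n+1}\bigl(H(\mathbb S^n\times[0,1))\bigr)\le C\,\Vert f-g\Vert_{W^{1,n}(\mathbb S^n)}\bigl(\Vert f-g\Vert_{W^{1,n}(\mathbb S^n)}+\Vert Dg\Vert_{L^{n+1}(\mathbb S^n)}\bigr)^n . $$ Here $\mathcal H^{n+1}$ is the $(n+1)$-dimensional Hausdorff measure on $\mathbb R^m$, $Du$ denotes the (weak) derivative of $u$ on $\mathbb S^n$, $|Du|$ is its Hilbert-Schmidt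 norm, $\Vert u\Vert_{W^{1,n}(\mathbb S^n)}=\bigl(\int_{\mathbb S^n}(|u|^n+|Du|^n)\,d\sigma\bigr)^{1/n}$ and $\Vert Dg\Vert_{L^{n+1}(\mathbb S^n)}=\bigl(\int_{\mathbb S^n}|Dg|^{n+1}\,d\sigma\bigr)^{1/(n+1)}$. -/

import Mathlib

open MeasureTheory Metric Set
open scoped Manifold ContDiff NNReal ENNReal RealInnerProductSpace

noncomputable section

namespace SphereSobolev

/-- The Euclidean space `ℝ^k`. -/
abbrev Euc (k : ℕ) : Type := EuclideanSpace ℝ (Fin k)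

/-- The unit sphere `S^n` of `ℝ^(n+1)`. -/
abbrev Sph (n : ℕ) : Type := sphere (0 : Euc (n + 1)) 1

/-- The surface measure of `S^n` (not normalized: its total mass is the area of `S^n`). -/
def surf (n : ℕ) : Measure (Sph n) := (volume : Measure (Euc (n + 1))).toSphere

/-- The Hilbert-Schmidt norm of a linear map `ℝ^k → ℝ^m`. -/
def hsNorm {k m : ℕ} (A : Euc k →L[ℝ] Euc m) : ℝ :=
  Real.sqrt (∑ i : Fin k, ‖A (EuclideanSpace.single i 1)‖ ^ 2)

/-- The orthogonal projection of `v` onto the tangent space of `S^n` at `x`. -/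
def tangentProj {n : ℕ} (x : Sph n) (v : Euc (n + 1)) : Euc (n + 1) :=
  v - ⟪v, (x : Euc (n + 1))⟫ • (x : Euc (n + 1))

/-- `G` is the weak derivative of `f : S^n → ℝ^m`. A linear map on the tangent space `T_x S^n` is
represented by a linear map on `ℝ^(n+1)` that vanishes on the normal direction `x` (this does not
change its Hilbert-Schmidt norm). The last condition is the integration by parts formula
`∫ G X = - ∫ f div X`, for the tangent vector fields `X = φ V`, where `φ` is smooth and `V` is the
tangential part of a constant vector `v`; the divergence of `V` on `S^n` is `- n ⟨v, x⟩`, and each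
smooth tangent vector field of `S^n` is a finite sum of fields of this form. -/
structure HasWeakDeriv {n m : ℕ} (f : Sph n → Euc m)
    (G : Sph n → Euc (n + 1) →L[ℝ] Euc m) : Prop where
  integrable : Integrable f (surf n)
  integrable_deriv : Integrable G (surf n)
  tangential : ∀ᵐ x ∂(surf n), G x (x : Euc (n + 1)) = 0
  integral_eq : ∀ (φ : Euc (n + 1) → ℝ), ContDiff ℝ ∞ φ → ∀ v : Euc (n + 1),
    ∫ x, φ (x : Euc (n + 1)) • G x v ∂(surf n) =
      - ∫ x, (fderiv ℝ φ (x : Euc (n + 1)) (tangentProj x v)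
          - n * ⟪v, (x : Euc (n + 1))⟫ * φ (x : Euc (n + 1))) • f x ∂(surf n)

/-- The Sobolev space `W^{1,p}(S^n, ℝ^m)`. -/
def MemW1 {n m : ℕ} (p : ℝ≥0) (f : Sph n → Euc m) : Prop :=
  MemLp f p (surf n) ∧
    ∃ G : Sph n → Euc (n + 1) →L[ℝ] Euc m, HasWeakDeriv f G ∧ MemLp G p (surf n)

open Classical in
/-- The weak derivative of `f` (unique up to null sets), and `0` if there is none. -/
def weakDeriv {n m : ℕ} (f : Sph n → Euc m) : Sph n → Euc (n + 1) →L[ℝ] Euc m :=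
  if h : ∃ G : Sph n → Euc (n + 1) →L[ℝ] Euc m, HasWeakDeriv f G then h.choose else 0

/-- The norm `(∫ |f|^p + |Df|^p)^(1/p)` of `W^{1,p}(S^n, ℝ^m)`. It is used only for
functions in this space. -/
def w1Norm {n m : ℕ} (p : ℝ≥0) (f : Sph n → Euc m) : ℝ≥0∞ :=
  (∫⁻ x, (ENNReal.ofReal (‖f x‖ ^ (p : ℝ)) + ENNReal.ofReal (hsNorm (weakDeriv f x) ^ (p : ℝ)))
    ∂(surf n)) ^ (1 / (p : ℝ))

theorem norm_inv_smul_mem_sphere {n : ℕ} {y : Euc (n + 1)} (hy : y ≠ 0) :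
    ‖y‖⁻¹ • y ∈ sphere (0 : Euc (n + 1)) 1 := by
  rw [mem_sphere_zero_iff_norm]
  exact norm_smul_inv_norm (𝕜 := ℝ) hy

open Classical in
/-- The extension of `g : S^n → ℝ^m` that is constant on rays, `y ↦ g (y / |y|)`. -/
def radialExt {n m : ℕ} (g : Sph n → Euc m) (y : Euc (n + 1)) : Euc m :=
  if h : y = 0 then 0 else g ⟨‖y‖⁻¹ • y, norm_inv_smul_mem_sphere h⟩

/-- The classical derivative `Dg(x)` of a smooth map `g : S^n → ℝ^m`, as a linear map on
`ℝ^(n+1)` that vanishes on the normal direction `x`. -/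
def sphDeriv {n m : ℕ} (g : Sph n → Euc m) (x : Sph n) : Euc (n + 1) →L[ℝ] Euc m :=
  fderiv ℝ (radialExt g) (x : Euc (n + 1))

end SphereSobolev

end

/-!
Write `u = f - g`. The homotopy is `H (x, t) = F ((1 + t) x)` for a map `F` on the shell
`1 ≤ |y| ≤ 2` (`shellMap`), namely

  `F y = g (y / |y|) + (|y| - 1) W y`,

where `W` (`mollExt`) is the mollification of the radial extension `y ↦ u (y / |y|)` at scale
`2 - |y|`. The variable scale makes `W` smooth for `|y| < 2`, while for continuous `u` it extends
continuously to `|y| = 2`, with boundary value `u`.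

The estimate rests on three facts.

* `HasWeakDeriv.fderiv_mollExt`: the derivative of `W` is an average of the weak derivative of `u`.
  Differentiating the kernel in the point and in the scale gives a divergence in the integration
  variable, which is moved to the radial extension of `u`; the weak derivative of that extension is
  the `(-1)`-homogeneous extension of `Du` (`HasWeakDeriv.integral_radialExt`). Hence
  `|W| + |DW|` is at most a constant times `A`, the average (`localAvg`) of `|u| + |Du|` at scale
  `2 - |y|`.
* `exists_hausdorffMeasure_image_le`: the `(n+1)`-dimensional measure of the image of `F` is at most
  a constant times the integral of the size of the radial derivative of `F` times the `n`-th power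
  of the size of its tangential derivative. The radial extension of `g` is constant on rays, so the
  radial derivative is `O(A)`, and the tangential one is `|Dg| + O(A)`
  (`enorm_fderiv_shellMap_le`). By Hölder's and Minkowski's inequalities
  (`lintegral_mul_add_pow_le`) the measure is then controlled by
  `‖A‖ (‖A‖ + ‖Dg‖) ^ n`, with norms in `L^(n+1)`.
* `exists_lintegral_localAvg_pow_le`: the `L^(n+1)` norm of `A` on the shell is at most a constant
  times the `L^n` norm `b` of `|u| + |Du|` on the sphere. The exponent is critical: the pointwise
  bound `A ≤ N b / (2 - |y|)` (`exists_localAvg_le`), used together with Jensen's inequality for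
  `A ^ n`, would leave the divergent integral of `1 / (2 - |y|)` in the radial variable. One factor
  `A` is therefore replaced by an average over points where `A ≤ 2 (|u| + |Du|)`; the minimum of
  the two bounds for `A` is integrable in the scale (`lintegral_min_div_pow_le`).

A linear map on the tangent space of the sphere is represented by a linear map on `ℝ^(n+1)`, so
everything on the sphere is transported to the shell by polar coordinates.
-/

noncomputable section

namespace SphereSobolev

/-! ### Polar coordinates -/

instance (n : ℕ) : IsFiniteMeasure (surf n) := by unfold surf; infer_instance

/-- The radial factor `ρ ^ n dρ` of Lebesgue measure on `ℝ^(n+1)`, as a measure on the line. -/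
def radM (n : ℕ) : Measure ℝ :=
  (volume.restrict (Ioi (0 : ℝ))).withDensity fun ρ => ENNReal.ofReal (ρ ^ n)

instance (n : ℕ) : SFinite (radM n) := by unfold radM; infer_instance

theorem radM_eq_map (n : ℕ) :
    radM n = (Measure.volumeIoiPow n).map (Subtype.val : Ioi (0 : ℝ) → ℝ) := by
  ext s hs
  rw [Measure.map_apply measurable_subtype_coe hs, radM, Measure.volumeIoiPow,
    withDensity_apply _ hs, withDensity_apply _ (measurable_subtype_coe hs),
    setLIntegral_subtype measurableSet_Ioi _ fun a : ℝ ↦ ENNReal.ofReal (a ^ n),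
    Measure.restrict_restrict hs, Subtype.image_preimage_coe, inter_comm]

theorem finrank_euc (n : ℕ) : Module.finrank ℝ (Euc (n + 1)) = n + 1 := by simp

theorem measurable_polar {n : ℕ} :
    Measurable fun p : Sph n × ℝ => p.2 • (p.1 : Euc (n + 1)) := by
  fun_prop

theorem measurePreserving_polar (n : ℕ) :
    MeasurePreserving (fun p : Sph n × ℝ => p.2 • (p.1 : Euc (n + 1)))
      ((surf n).prod (radM n)) volume := by
  refine ⟨measurable_polar, ?_⟩
  have h1 := (volume : Measure (Euc (n + 1))).measurePreserving_homeomorphUnitSphereProd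
  rw [finrank_euc, Nat.add_sub_cancel] at h1
  have h2 := (MeasurePreserving.symm (homeomorphUnitSphereProd (Euc (n + 1))).toMeasurableEquiv
    h1).map_eq
  have h3 : (surf n).prod (radM n) =
      ((surf n).prod (Measure.volumeIoiPow n)).map (Prod.map id Subtype.val) := by
    rw [radM_eq_map, ← Measure.map_prod_map _ _ measurable_id measurable_subtype_coe,
      Measure.map_id]
  rw [h3, Measure.map_map measurable_polar (by fun_prop)]
  have h4 : (fun p : Sph n × ℝ => p.2 • (p.1 : Euc (n + 1))) ∘
      (Prod.map id (Subtype.val : Ioi (0 : ℝ) → ℝ)) =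
      Subtype.val ∘ (homeomorphUnitSphereProd (Euc (n + 1))).toMeasurableEquiv.symm := by
    ext p : 1
    simp
  rw [h4, ← Measure.map_map measurable_subtype_coe (MeasurableEquiv.measurable _)]
  unfold surf
  rw [h2, (MeasurableEmbedding.subtype_coe (measurableSet_singleton _).compl).map_comap]
  simp only [Subtype.range_coe]
  exact Measure.restrict_eq_self_of_ae_mem (by simp [ae_iff])

theorem lintegral_polar {n : ℕ} {F : Euc (n + 1) → ℝ≥0∞} (hF : Measurable F) :
    ∫⁻ y, F y = ∫⁻ ρ in Ioi (0 : ℝ), ENNReal.ofReal (ρ ^ n) *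
      ∫⁻ x : Sph n, F (ρ • (x : Euc (n + 1))) ∂(surf n) := by
  have hm : Measurable fun p : Sph n × ℝ => F (p.2 • (p.1 : Euc (n + 1))) :=
    hF.comp measurable_polar
  rw [← (measurePreserving_polar n).lintegral_comp hF, lintegral_prod_symm _ hm.aemeasurable, radM,
    lintegral_withDensity_eq_lintegral_mul _ (by fun_prop)]
  · rfl
  · exact Measurable.lintegral_prod_left' hm

theorem integrable_polar {n : ℕ} {X : Type*} [NormedAddCommGroup X]
    {F : Euc (n + 1) → X} (hF : Integrable F) :
    Integrable (fun p : Sph n × ℝ => F (p.2 • (p.1 : Euc (n + 1)))) ((surf n).prod (radM n)) :=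
  (measurePreserving_polar n).integrable_comp_of_integrable hF

theorem integral_polar_eq_prod {n : ℕ} {X : Type*} [NormedAddCommGroup X] [NormedSpace ℝ X]
    {F : Euc (n + 1) → X} (hF : Integrable F) :
    ∫ y, F y = ∫ p, F (p.2 • (p.1 : Euc (n + 1))) ∂((surf n).prod (radM n)) := by
  rw [← (measurePreserving_polar n).map_eq, integral_map measurable_polar.aemeasurable]
  rw [(measurePreserving_polar n).map_eq]
  exact hF.aestronglyMeasurable

theorem integral_radM {n : ℕ} {X : Type*} [NormedAddCommGroup X] [NormedSpace ℝ X] (F : ℝ → X) :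
    ∫ ρ, F ρ ∂(radM n) = ∫ ρ in Ioi (0 : ℝ), ρ ^ n • F ρ := by
  unfold radM
  have : (fun ρ : ℝ => ENNReal.ofReal (ρ ^ n)) = fun ρ => ((ρ ^ n).toNNReal : ℝ≥0∞) := rfl
  rw [this, integral_withDensity_eq_integral_smul (by fun_prop)]
  refine setIntegral_congr_fun measurableSet_Ioi fun ρ hρ => ?_
  have : (0 : ℝ) ≤ ρ ^ n := pow_nonneg (le_of_lt hρ) n
  simp [NNReal.smul_def, Real.coe_toNNReal _ this]

theorem integral_polar {n : ℕ} {X : Type*} [NormedAddCommGroup X] [NormedSpace ℝ X]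
    {F : Euc (n + 1) → X} (hF : Integrable F) :
    ∫ y, F y = ∫ ρ in Ioi (0 : ℝ), ρ ^ n • ∫ x : Sph n, F (ρ • (x : Euc (n + 1))) ∂(surf n) := by
  rw [integral_polar_eq_prod hF, integral_prod_symm _ (integrable_polar hF), integral_radM]

theorem integral_polar' {n : ℕ} {X : Type*} [NormedAddCommGroup X] [NormedSpace ℝ X]
    {F : Euc (n + 1) → X} (hF : Integrable F) :
    ∫ y, F y = ∫ x : Sph n,
      (∫ ρ in Ioi (0 : ℝ), ρ ^ n • F (ρ • (x : Euc (n + 1)))) ∂(surf n) := by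
  rw [integral_polar_eq_prod hF, integral_prod _ (integrable_polar hF)]
  simp_rw [integral_radM]

/-! ### Radial extension -/

open Classical in
/-- The radial projection `y ↦ y / |y|` onto the sphere, with an arbitrary value at the origin. -/
def rdir {n : ℕ} (y : Euc (n + 1)) : Sph n :=
  ⟨if y = 0 then EuclideanSpace.single 0 1 else ‖y‖⁻¹ • y, by
    split_ifs with h
    · simp
    · exact norm_inv_smul_mem_sphere h⟩

theorem coe_rdir {n : ℕ} {y : Euc (n + 1)} (hy : y ≠ 0) :
    (rdir y : Euc (n + 1)) = ‖y‖⁻¹ • y := by simp [rdir, hy]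

theorem norm_sph {n : ℕ} (x : Sph n) : ‖(x : Euc (n + 1))‖ = 1 := by simp

theorem sph_ne_zero {n : ℕ} (x : Sph n) : (x : Euc (n + 1)) ≠ 0 := ne_zero_of_mem_unit_sphere x

theorem smul_sph_ne_zero {n : ℕ} {ρ : ℝ} (hρ : 0 < ρ) (x : Sph n) : ρ • (x : Euc (n + 1)) ≠ 0 :=
  smul_ne_zero hρ.ne' (sph_ne_zero x)

theorem norm_smul_sph {n : ℕ} {ρ : ℝ} (hρ : 0 < ρ) (x : Sph n) : ‖ρ • (x : Euc (n + 1))‖ = ρ := by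
  rw [norm_smul, norm_sph, mul_one, Real.norm_of_nonneg hρ.le]

theorem rdir_smul {n : ℕ} {ρ : ℝ} (hρ : 0 < ρ) (x : Sph n) : rdir (ρ • (x : Euc (n + 1))) = x := by
  ext1
  rw [coe_rdir (smul_sph_ne_zero hρ x), norm_smul_sph hρ, inv_smul_smul₀ hρ.ne']

theorem rdir_sph {n : ℕ} (x : Sph n) : rdir (x : Euc (n + 1)) = x := by
  simpa using rdir_smul one_pos x

theorem norm_smul_rdir {n : ℕ} {y : Euc (n + 1)} (hy : y ≠ 0) :
    ‖y‖ • (rdir y : Euc (n + 1)) = y := by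
  rw [coe_rdir hy, smul_inv_smul₀ (norm_ne_zero_iff.2 hy)]

theorem radialExt_eq {n m : ℕ} (g : Sph n → Euc m) {y : Euc (n + 1)} (hy : y ≠ 0) :
    radialExt g y = g (rdir y) := by
  rw [radialExt, dif_neg hy]
  congr 1
  ext1
  rw [coe_rdir hy]

theorem radialExt_smul {n m : ℕ} (g : Sph n → Euc m) {ρ : ℝ} (hρ : 0 < ρ) (x : Sph n) :
    radialExt g (ρ • (x : Euc (n + 1))) = g x := by
  rw [radialExt_eq g (smul_sph_ne_zero hρ x), rdir_smul hρ]

theorem measurable_rdir {n : ℕ} : Measurable (rdir : Euc (n + 1) → Sph n) := by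
  refine Measurable.subtype_mk ?_
  exact Measurable.ite (measurableSet_singleton 0) measurable_const (by fun_prop)

theorem continuousOn_rdir {n : ℕ} : ContinuousOn (rdir : Euc (n + 1) → Sph n) {0}ᶜ := by
  refine Topology.IsInducing.subtypeVal.continuousOn_iff.2 ?_
  refine ContinuousOn.congr (f := fun y : Euc (n + 1) => ‖y‖⁻¹ • y) ?_ fun y hy => coe_rdir hy
  exact (continuousOn_id.norm.inv₀ fun y hy => norm_ne_zero_iff.2 hy).smul continuousOn_id

theorem continuousOn_radialExt {n m : ℕ} {g : Sph n → Euc m} (hg : Continuous g) :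
    ContinuousOn (radialExt g) {0}ᶜ :=
  (hg.comp_continuousOn continuousOn_rdir).congr fun _ hy => radialExt_eq g hy

theorem quasiMeasurePreserving_rdir (n : ℕ) :
    Measure.QuasiMeasurePreserving (rdir : Euc (n + 1) → Sph n) volume (surf n) := by
  refine ⟨measurable_rdir, Measure.AbsolutelyContinuous.mk fun N hN h0 => ?_⟩
  rw [Measure.map_apply measurable_rdir hN, ← lintegral_indicator_one (measurable_rdir hN),
    lintegral_polar (measurable_one.indicator (measurable_rdir hN)), setLIntegral_eq_zero_iff
      measurableSet_Ioi]
  · refine Filter.Eventually.of_forall fun ρ hρ => ?_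
    have : ∀ x : Sph n, (rdir ⁻¹' N).indicator (1 : Euc (n + 1) → ℝ≥0∞)
        (ρ • (x : Euc (n + 1))) = N.indicator 1 x := by
      intro x
      have hx : ρ • (x : Euc (n + 1)) ∈ rdir ⁻¹' N ↔ x ∈ N := by rw [mem_preimage, rdir_smul hρ]
      by_cases h : x ∈ N
      · rw [indicator_of_mem (hx.2 h), indicator_of_mem h]; rfl
      · rw [indicator_of_notMem (mt hx.1 h), indicator_of_notMem h]
    simp [this, lintegral_indicator_one hN, h0]
  · have : Measurable fun p : ℝ × Sph n => (rdir ⁻¹' N).indicator (1 : Euc (n + 1) → ℝ≥0∞)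
        (p.1 • (p.2 : Euc (n + 1))) :=
      (measurable_one.indicator (measurable_rdir hN)).comp (by fun_prop)
    exact (by fun_prop : Measurable fun ρ : ℝ => ENNReal.ofReal (ρ ^ n)).mul
      this.lintegral_prod_right'

theorem hasFDerivAt_norm_euc {n : ℕ} {y : Euc (n + 1)} (hy : y ≠ 0) :
    HasFDerivAt (fun z : Euc (n + 1) => ‖z‖) (innerSL ℝ (rdir y : Euc (n + 1))) y := by
  have h := ((hasStrictFDerivAt_norm_sq y).hasFDerivAt).sqrt (by simpa using hy)
  simp only [Real.sqrt_sq (norm_nonneg _)] at h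
  convert! h using 1
  ext v
  rw [coe_rdir hy]
  simp
  ring

/-- The derivative of the radial projection at a point of the sphere is the orthogonal projection
onto the tangent space. -/
theorem hasFDerivAt_normalize {n : ℕ} (x : Sph n) :
    HasFDerivAt (fun z : Euc (n + 1) => ‖z‖⁻¹ • z)
      (ContinuousLinearMap.id ℝ _ -
        (innerSL ℝ (x : Euc (n + 1))).smulRight (x : Euc (n + 1))) (x : Euc (n + 1)) := by
  have h1 := hasFDerivAt_norm_euc (sph_ne_zero x)
  rw [rdir_sph] at h1
  have h2 := ((hasDerivAt_inv (x := ‖(x : Euc (n + 1))‖) (by simp)).comp_hasFDerivAt _ h1).smul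
    (hasFDerivAt_id (x : Euc (n + 1)))
  convert! h2 using 1
  ext1 v
  simp [sub_eq_add_neg]

theorem contDiffAt_normalize {n : ℕ} {y : Euc (n + 1)} (hy : y ≠ 0) :
    ContDiffAt ℝ ∞ (fun z : Euc (n + 1) => ‖z‖⁻¹ • z) y :=
  ((contDiffAt_norm ℝ hy).inv (norm_ne_zero_iff.2 hy)).smul contDiffAt_id

/-- The radial extension of a smooth map is smooth away from the origin. Near a point `y`, radial
projection is replaced by a globally defined smooth map into the sphere: a map that is the identity
near `y` and takes values in a small ball about `y` is composed with normalization. -/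
theorem contDiffAt_radialExt {n m : ℕ} {g : Sph n → Euc m}
    (hg : ContMDiff (𝓡 n) 𝓘(ℝ, Euc m) ∞ g) {y : Euc (n + 1)} (hy : y ≠ 0) :
    ContDiffAt ℝ ∞ (radialExt g) y := by
  have hy' : 0 < ‖y‖ := norm_pos_iff.2 hy
  let β : ContDiffBump y := ⟨‖y‖ / 4, ‖y‖ / 2, by positivity, by linarith⟩
  let q : Euc (n + 1) → Euc (n + 1) := fun z => y + β z • (z - y)
  have hq : ContDiff ℝ ∞ q := contDiff_const.add (β.contDiff.smul (contDiff_id.sub contDiff_const))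
  have hq0 : ∀ z, q z ≠ 0 := by
    intro z hz
    have h1 : ‖β z • (z - y)‖ = ‖y‖ := by
      rw [← norm_neg y]; congr 1
      exact (neg_eq_of_add_eq_zero_right hz).symm
    have h2 : ‖β z • (z - y)‖ ≤ ‖y‖ / 2 := by
      by_cases hz' : dist z y < ‖y‖ / 2
      · rw [norm_smul, Real.norm_of_nonneg β.nonneg, ← dist_eq_norm]
        nlinarith [β.le_one (x := z), β.nonneg (x := z), dist_nonneg (x := z) (y := y)]
      · rw [β.zero_of_le_dist (not_lt.1 hz')]
        simpa using (half_pos hy').le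
    linarith
  have hp : ContDiff ℝ ∞ fun z => ‖q z‖⁻¹ • q z := contDiff_iff_contDiffAt.2 fun z =>
    (contDiffAt_normalize (hq0 z)).comp z hq.contDiffAt
  have : Fact (Module.finrank ℝ (Euc (n + 1)) = n + 1) := ⟨finrank_euc n⟩
  have hp' : ∀ z, ‖q z‖⁻¹ • q z ∈ sphere (0 : Euc (n + 1)) 1 :=
    fun z => norm_inv_smul_mem_sphere (hq0 z)
  have h3 : ContDiff ℝ ∞ fun z => g ⟨‖q z‖⁻¹ • q z, hp' z⟩ :=
    (hg.comp (ContMDiff.codRestrict_sphere hp.contMDiff hp')).contDiff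
  refine h3.contDiffAt.congr_of_eventuallyEq ?_
  filter_upwards [ball_mem_nhds y (show 0 < ‖y‖ / 4 by positivity)] with z hz
  have hβ : β z = 1 := β.one_of_mem_closedBall (ball_subset_closedBall hz)
  have hqz : q z = z := by simp [q, hβ]
  have hz0 : z ≠ 0 := hqz ▸ hq0 z
  rw [radialExt, dif_neg hz0]
  congr 2
  simp [hqz]

/-! ### Weak derivative of the radial extension -/

theorem lintegral_radial_mul {n : ℕ} {a : ℝ → ℝ≥0∞} (ha : Measurable a) {b : Sph n → ℝ≥0∞}
    (hb : AEMeasurable b (surf n)) :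
    ∫⁻ y : Euc (n + 1), a ‖y‖ * b (rdir y) =
      (∫⁻ ρ in Ioi (0 : ℝ), ENNReal.ofReal (ρ ^ n) * a ρ) * ∫⁻ x, b x ∂(surf n) := by
  have h1 : ∫⁻ y : Euc (n + 1), a ‖y‖ * b (rdir y) =
      ∫⁻ y : Euc (n + 1), a ‖y‖ * hb.mk b (rdir y) := by
    refine lintegral_congr_ae ?_
    filter_upwards [(quasiMeasurePreserving_rdir n).ae_eq hb.ae_eq_mk] with y hy
    simp only [Function.comp_apply] at hy
    rw [hy]
  have hm : Measurable fun y : Euc (n + 1) => a ‖y‖ * hb.mk b (rdir y) :=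
    (ha.comp measurable_norm).mul (hb.measurable_mk.comp measurable_rdir)
  rw [h1, lintegral_polar hm, lintegral_congr_ae hb.ae_eq_mk,
    ← lintegral_mul_const _ (by fun_prop)]
  refine setLIntegral_congr_fun measurableSet_Ioi fun ρ hρ => ?_
  simp only [norm_smul_sph hρ, rdir_smul hρ]
  rw [lintegral_const_mul _ hb.measurable_mk, mul_assoc]

theorem integrableOn_comp_rdir {n : ℕ} {X : Type*} [NormedAddCommGroup X] {h : Sph n → X}
    (hh : Integrable h (surf n)) (R : ℝ) :
    IntegrableOn (fun y : Euc (n + 1) => h (rdir y)) (closedBall 0 R) := by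
  refine ⟨(hh.aestronglyMeasurable.comp_quasiMeasurePreserving
    (quasiMeasurePreserving_rdir n)).restrict, ?_⟩
  rw [HasFiniteIntegral, ← lintegral_indicator measurableSet_closedBall]
  have h1 : ∀ y : Euc (n + 1), (closedBall (0 : Euc (n + 1)) R).indicator
      (fun y => ‖h (rdir y)‖ₑ) y = (Iic R).indicator 1 ‖y‖ * ‖h (rdir y)‖ₑ := by
    intro y
    by_cases hy : ‖y‖ ≤ R
    · rw [indicator_of_mem (by simpa using hy), indicator_of_mem (by exact hy), Pi.one_apply,
        one_mul]
    · rw [indicator_of_notMem (by simpa using hy), indicator_of_notMem (by exact hy), zero_mul]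
  simp_rw [h1]
  rw [lintegral_radial_mul (measurable_one.indicator measurableSet_Iic)
    hh.aestronglyMeasurable.enorm]
  refine ENNReal.mul_lt_top ?_ hh.2
  calc ∫⁻ ρ in Ioi (0 : ℝ), ENNReal.ofReal (ρ ^ n) * (Iic R).indicator 1 ρ
      ≤ ∫⁻ ρ in Ioi (0 : ℝ), (Iic R).indicator (fun _ => ENNReal.ofReal (R ^ n)) ρ := by
        refine setLIntegral_mono' measurableSet_Ioi fun ρ hρ => ?_
        by_cases h : ρ ≤ R
        · rw [indicator_of_mem (by exact h), indicator_of_mem (by exact h), Pi.one_apply, mul_one]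
          exact ENNReal.ofReal_le_ofReal (pow_le_pow_left₀ (le_of_lt hρ) h n)
        · rw [indicator_of_notMem (by exact h), mul_zero]; exact zero_le
    _ = ENNReal.ofReal (R ^ n) * volume (Iic R ∩ Ioi 0) := by
        rw [lintegral_indicator measurableSet_Iic, lintegral_const,
          Measure.restrict_restrict measurableSet_Iic, Measure.restrict_apply_univ]
    _ < ⊤ := by
        rw [inter_comm, Ioi_inter_Iic, Real.volume_Ioc]
        exact ENNReal.mul_lt_top ENNReal.ofReal_lt_top ENNReal.ofReal_lt_top

theorem locallyIntegrable_comp_rdir {n : ℕ} {X : Type*} [NormedAddCommGroup X] {h : Sph n → X}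
    (hh : Integrable h (surf n)) : LocallyIntegrable (fun y : Euc (n + 1) => h (rdir y)) := by
  intro x
  exact ⟨closedBall 0 (‖x‖ + 1), closedBall_mem_nhds_of_mem (by simp),
    integrableOn_comp_rdir hh _⟩

theorem integrable_smul_comp_rdir {n : ℕ} {X : Type*} [NormedAddCommGroup X] [NormedSpace ℝ X]
    {h : Sph n → X} (hh : Integrable h (surf n)) {κ : Euc (n + 1) → ℝ} (hκ : Measurable κ)
    {M R : ℝ} (hM : ∀ y, |κ y| ≤ M) (hR : ∀ y, R < ‖y‖ → κ y = 0) :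
    Integrable fun y : Euc (n + 1) => κ y • h (rdir y) := by
  refine (integrableOn_iff_integrable_of_support_subset (s := closedBall 0 R) ?_).1 ?_
  · intro y hy
    by_contra h
    exact hy (by simp [hR y (by simpa using h)])
  · exact (integrableOn_comp_rdir hh R).bdd_smul M hκ.aestronglyMeasurable
      (Filter.Eventually.of_forall hM)

/-- Integration by parts on a ray against the radial density `ρ ^ n`. -/
theorem integral_radial_deriv_eq_zero {n : ℕ} {ψ : ℝ → ℝ} (hψ : ContDiff ℝ 1 ψ)
    (hc : HasCompactSupport ψ) (h0 : ψ 0 = 0) :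
    ∫ ρ in Ioi (0 : ℝ), ρ ^ n * (deriv ψ ρ + n * ρ⁻¹ * ψ ρ) = 0 := by
  have hd : ∀ ρ, HasDerivAt (fun ρ => ρ ^ n * ψ ρ)
      ((n : ℝ) * ρ ^ (n - 1) * ψ ρ + ρ ^ n * deriv ψ ρ) ρ := fun ρ =>
    (hasDerivAt_pow n ρ).mul ((hψ.differentiable one_ne_zero) ρ).hasDerivAt
  have h1 := HasCompactSupport.integral_Ioi_deriv_eq (f := fun ρ : ℝ => ρ ^ n * ψ ρ)
    ((contDiff_id.pow n).mul hψ) hc.mul_left 0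
  simp only [h0, mul_zero, neg_zero] at h1
  refine Eq.trans (setIntegral_congr_fun (measurableSet_Ioi (a := (0 : ℝ))) fun ρ hρ => ?_) h1
  have hρ0 : ρ ≠ 0 := ne_of_gt hρ
  refine Eq.trans ?_ (hd ρ).deriv.symm
  rcases n with _ | k
  · simp
  · simp only [Nat.add_sub_cancel]
    field_simp
    ring

/-- The weak derivative of the `0`-homogeneous extension of a Sobolev function is the
`(-1)`-homogeneous extension of its weak derivative, on test functions supported away from the
origin. -/
theorem HasWeakDeriv.integral_radialExt {n m : ℕ} {f : Sph n → Euc m}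
    {G : Sph n → Euc (n + 1) →L[ℝ] Euc m} (h : HasWeakDeriv f G) {ψ : Euc (n + 1) → ℝ}
    (hψ : ContDiff ℝ ∞ ψ) {a R : ℝ} (ha : 0 < a) (hψa : ∀ y, ‖y‖ < a → ψ y = 0)
    (hψR : ∀ y, R < ‖y‖ → ψ y = 0) (e : Euc (n + 1)) :
    Integrable (fun y => fderiv ℝ ψ y e • f (rdir y) + (‖y‖⁻¹ * ψ y) • G (rdir y) e) ∧
      ∫ y, (fderiv ℝ ψ y e • f (rdir y) + (‖y‖⁻¹ * ψ y) • G (rdir y) e) = 0 := by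
  have hdψ : Continuous (fderiv ℝ ψ) := hψ.continuous_fderiv (by simp)
  have hcs : HasCompactSupport ψ := HasCompactSupport.intro (isCompact_closedBall 0 R)
    fun y hy => hψR y (by simpa using hy)
  have hdR : ∀ y, R < ‖y‖ → fderiv ℝ ψ y = 0 := fun y hy => by
    have : ψ =ᶠ[nhds y] fun _ => 0 := by
      filter_upwards [(isOpen_lt continuous_const continuous_norm).mem_nhds hy] with z hz
      exact hψR z hz
    rw [this.fderiv_eq]; simp
  obtain ⟨M, hM⟩ := hcs.exists_bound_of_continuous hψ.continuous
  obtain ⟨M', hM'⟩ := (hcs.fderiv ℝ).exists_bound_of_continuous hdψ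
  have hM0 : 0 ≤ M := (norm_nonneg _).trans (hM 0)
  have hinv : ∀ y, |‖y‖⁻¹ * ψ y| ≤ a⁻¹ * M := by
    intro y
    by_cases hy : ‖y‖ < a
    · rw [hψa y hy]; simp; positivity
    · rw [abs_mul, abs_of_nonneg (by positivity : 0 ≤ ‖y‖⁻¹)]
      gcongr
      · exact not_lt.1 hy
      · exact hM y
  have hrn : ∀ y : Euc (n + 1), ‖(rdir y : Euc (n + 1))‖ = 1 := fun y => norm_sph _
  have hmr : Measurable fun y : Euc (n + 1) => (rdir y : Euc (n + 1)) :=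
    measurable_subtype_coe.comp measurable_rdir
  have hin : ∀ y : Euc (n + 1), |⟪e, (rdir y : Euc (n + 1))⟫| ≤ ‖e‖ := fun y => by
    simpa using abs_real_inner_le_norm e (rdir y : Euc (n + 1))
  -- The tangential part of the direction `e`: integration by parts on each sphere.
  let κ₁ : Euc (n + 1) → ℝ := fun y =>
    fderiv ℝ ψ y (tangentProj (rdir y) e) - n * ⟪e, (rdir y : Euc (n + 1))⟫ * (‖y‖⁻¹ * ψ y)
  -- The normal part of the direction `e`: integration by parts on each ray.
  let κ₂ : Euc (n + 1) → ℝ := fun y =>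
    ⟪e, (rdir y : Euc (n + 1))⟫ * (fderiv ℝ ψ y (rdir y) + n * ‖y‖⁻¹ * ψ y)
  have hsum : ∀ y, fderiv ℝ ψ y e • f (rdir y) + (‖y‖⁻¹ * ψ y) • G (rdir y) e =
      (κ₁ y • f (rdir y) + (‖y‖⁻¹ * ψ y) • G (rdir y) e) + κ₂ y • f (rdir y) := by
    intro y
    have : fderiv ℝ ψ y e = κ₁ y + κ₂ y := by
      simp only [κ₁, κ₂, tangentProj, map_sub, map_smul, smul_eq_mul]; ring
    rw [this, add_smul]; abel
  have mdψ : ∀ w : Euc (n + 1) → Euc (n + 1), Measurable w →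
      Measurable fun y => fderiv ℝ ψ y (w y) := fun w hw =>
    (isBoundedBilinearMap_apply.continuous.measurable).comp (hdψ.measurable.prodMk hw)
  have mψ := hψ.continuous.measurable
  have hmin : Measurable fun y : Euc (n + 1) => ⟪e, (rdir y : Euc (n + 1))⟫ := by fun_prop
  have mtp : Measurable fun y : Euc (n + 1) => tangentProj (rdir y) e := by
    unfold tangentProj; fun_prop
  have hi1 : Integrable fun y => κ₁ y • f (rdir y) := by
    refine integrable_smul_comp_rdir h.integrable (M := M' * (‖e‖ + ‖e‖) + n * ‖e‖ * (a⁻¹ * M))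
      (R := R) ((mdψ _ mtp).sub (by fun_prop)) (fun y => ?_) fun y hy => ?_
    · refine (abs_sub _ _).trans (add_le_add ?_ ?_)
      · refine ((fderiv ℝ ψ y).le_opNorm _).trans ?_
        have h2 : ‖tangentProj (rdir y) e‖ ≤ ‖e‖ + ‖e‖ := by
          refine (norm_sub_le _ _).trans ?_
          gcongr
          rw [norm_smul, hrn, mul_one]
          exact hin y
        exact mul_le_mul (hM' y) h2 (norm_nonneg _) ((norm_nonneg _).trans (hM' y))
      · rw [abs_mul, abs_mul, Nat.abs_cast]
        gcongr
        · exact hin y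
        · exact hinv y
    · simp [κ₁, hdR y hy, hψR y hy]
  have hi2 : Integrable fun y => (‖y‖⁻¹ * ψ y) • G (rdir y) e :=
    integrable_smul_comp_rdir (h.integrable_deriv.apply_continuousLinearMap e) (by fun_prop) hinv
      (R := R) fun y hy => by simp [hψR y hy]
  have hi3 : Integrable fun y => κ₂ y • f (rdir y) := by
    refine integrable_smul_comp_rdir h.integrable (M := ‖e‖ * (M' * 1 + n * (a⁻¹ * M)))
      (R := R) (hmin.mul ((mdψ _ hmr).add (by fun_prop))) (fun y => ?_) fun y hy => ?_
    · rw [abs_mul]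
      gcongr
      · exact hin y
      · refine (abs_add_le _ _).trans (add_le_add ?_ ?_)
        · refine ((fderiv ℝ ψ y).le_opNorm _).trans ?_
          rw [hrn]
          exact mul_le_mul_of_nonneg_right (hM' y) zero_le_one
        · rw [mul_assoc, abs_mul, Nat.abs_cast]
          gcongr
          exact hinv y
    · simp [κ₂, hdR y hy, hψR y hy]
  simp_rw [hsum]
  have hi12 : Integrable fun y => κ₁ y • f (rdir y) + (‖y‖⁻¹ * ψ y) • G (rdir y) e :=
    hi1.add hi2
  refine ⟨hi12.add hi3, ?_⟩
  rw [integral_add hi12 hi3, integral_polar hi12, integral_polar' hi3]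
  have e1 : ∀ ρ ∈ Ioi (0 : ℝ), ρ ^ n • ∫ x : Sph n, (κ₁ (ρ • (x : Euc (n + 1))) •
      f (rdir (ρ • (x : Euc (n + 1)))) + (‖ρ • (x : Euc (n + 1))‖⁻¹ * ψ (ρ • (x : Euc (n + 1)))) •
        G (rdir (ρ • (x : Euc (n + 1)))) e) ∂(surf n) = 0 := by
    intro ρ hρ
    have hρ0 : ρ ≠ 0 := ne_of_gt hρ
    have hφ : ContDiff ℝ ∞ fun y => ψ (ρ • y) := hψ.comp (contDiff_const_smul ρ)
    have hφd : ∀ y v, fderiv ℝ (fun y => ψ (ρ • y)) y v = ρ * fderiv ℝ ψ (ρ • y) v := by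
      intro y v
      have h1 := (((hψ.differentiable (by simp)) (ρ • y)).hasFDerivAt.comp y
        ((hasFDerivAt_id y).const_smul ρ)).fderiv
      simp only [Function.comp_def] at h1
      rw [h1]; simp
    have hw := h.integral_eq _ hφ e
    have hJ1 : Integrable (fun x : Sph n => ψ (ρ • (x : Euc (n + 1))) • G x e) (surf n) :=
      (h.integrable_deriv.apply_continuousLinearMap e).bdd_smul M
        ((hψ.continuous.comp (by fun_prop)).aestronglyMeasurable)
        (Filter.Eventually.of_forall fun x => hM _)
    have hJ2 : Integrable (fun x : Sph n => (fderiv ℝ (fun y => ψ (ρ • y)) (x : Euc (n + 1))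
        (tangentProj x e) - n * ⟪e, (x : Euc (n + 1))⟫ * ψ (ρ • (x : Euc (n + 1)))) • f x)
        (surf n) := by
      have hcont : Continuous fun x : Sph n => (fderiv ℝ (fun y => ψ (ρ • y)) (x : Euc (n + 1))
          (tangentProj x e) - n * ⟪e, (x : Euc (n + 1))⟫ * ψ (ρ • (x : Euc (n + 1)))) := by
        have : Continuous fun x : Sph n => fderiv ℝ (fun y => ψ (ρ • y)) (x : Euc (n + 1)) :=
          (hφ.continuous_fderiv (by simp)).comp continuous_subtype_val
        unfold tangentProj
        have := hψ.continuous
        fun_prop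
      obtain ⟨K, hK⟩ := (isCompact_univ (X := Sph n)).exists_bound_of_continuousOn
        hcont.continuousOn
      exact h.integrable.bdd_smul K hcont.aestronglyMeasurable
        (Filter.Eventually.of_forall fun x => hK x trivial)
    have e2 : ∫ x : Sph n, (κ₁ (ρ • (x : Euc (n + 1))) •
      f (rdir (ρ • (x : Euc (n + 1)))) + (‖ρ • (x : Euc (n + 1))‖⁻¹ * ψ (ρ • (x : Euc (n + 1)))) •
        G (rdir (ρ • (x : Euc (n + 1)))) e) ∂(surf n) =
        ρ⁻¹ • ∫ x : Sph n, ((fderiv ℝ (fun y => ψ (ρ • y)) (x : Euc (n + 1))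
        (tangentProj x e) - n * ⟪e, (x : Euc (n + 1))⟫ * ψ (ρ • (x : Euc (n + 1)))) • f x +
        ψ (ρ • (x : Euc (n + 1))) • G x e) ∂(surf n) := by
      rw [← integral_smul]
      congr 1
      funext x
      simp only [κ₁, rdir_smul hρ, norm_smul_sph hρ, hφd, smul_add, smul_smul]
      congr 2
      field_simp
    rw [e2, integral_add hJ2 hJ1, hw]
    simp
  rw [setIntegral_congr_fun measurableSet_Ioi e1]
  have e3 : ∀ x : Sph n, (∫ ρ in Ioi (0 : ℝ), ρ ^ n • κ₂ (ρ • (x : Euc (n + 1))) •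
      f (rdir (ρ • (x : Euc (n + 1))))) = 0 := by
    intro x
    have hψx : ContDiff ℝ 1 fun ρ : ℝ => ψ (ρ • (x : Euc (n + 1))) :=
      (hψ.of_le (by simp)).comp (contDiff_id.smul contDiff_const)
    have hcx : HasCompactSupport fun ρ : ℝ => ψ (ρ • (x : Euc (n + 1))) :=
      HasCompactSupport.intro (isCompact_closedBall 0 R) fun ρ hρ => hψR _ (by
        rw [norm_smul, norm_sph, mul_one]
        simpa using hρ)
    have hI := integral_radial_deriv_eq_zero (n := n) hψx hcx (by simpa using hψa 0 (by simpa))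
    have hder : ∀ ρ : ℝ, deriv (fun ρ : ℝ => ψ (ρ • (x : Euc (n + 1)))) ρ =
        fderiv ℝ ψ (ρ • (x : Euc (n + 1))) x := by
      intro ρ
      have h1 := (((hψ.differentiable (by simp)) (ρ • (x : Euc (n + 1)))).hasFDerivAt
        |>.comp_hasDerivAt ρ ((hasDerivAt_id ρ).smul_const (x : Euc (n + 1)))).deriv
      simpa [Function.comp_def] using h1
    have e4 : ∀ ρ ∈ Ioi (0 : ℝ), ρ ^ n • κ₂ (ρ • (x : Euc (n + 1))) •
        f (rdir (ρ • (x : Euc (n + 1)))) =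
        (ρ ^ n * (deriv (fun ρ : ℝ => ψ (ρ • (x : Euc (n + 1)))) ρ +
          n * ρ⁻¹ * ψ (ρ • (x : Euc (n + 1))))) • ⟪e, (x : Euc (n + 1))⟫ • f x := by
      intro ρ hρ
      simp only [κ₂, rdir_smul hρ, norm_smul_sph hρ, hder, smul_smul]
      congr 1
      ring
    rw [setIntegral_congr_fun measurableSet_Ioi e4, integral_smul_const, hI, zero_smul]
  simp [e3]

/-! ### Weak derivatives of smooth maps -/

section Smooth

variable {n m : ℕ} {g : Sph n → Euc m}

theorem continuousAt_fderiv_radialExt (hg : ContMDiff (𝓡 n) 𝓘(ℝ, Euc m) ∞ g) {y : Euc (n + 1)}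
    (hy : y ≠ 0) : ContinuousAt (fderiv ℝ (radialExt g)) y :=
  ((contDiffAt_radialExt hg hy).fderiv_right (m := 0) (by simp)).continuousAt

theorem hasFDerivAt_radialExt (hg : ContMDiff (𝓡 n) 𝓘(ℝ, Euc m) ∞ g) {y : Euc (n + 1)}
    (hy : y ≠ 0) : HasFDerivAt (radialExt g) (fderiv ℝ (radialExt g) y) y :=
  ((contDiffAt_radialExt hg hy).differentiableAt (by simp)).hasFDerivAt

theorem continuous_sphDeriv (hg : ContMDiff (𝓡 n) 𝓘(ℝ, Euc m) ∞ g) : Continuous (sphDeriv g) :=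
  continuous_iff_continuousAt.2 fun x =>
    ContinuousAt.comp (continuousAt_fderiv_radialExt hg (sph_ne_zero x))
      continuous_subtype_val.continuousAt

theorem fderiv_radialExt_smul (hg : ContMDiff (𝓡 n) 𝓘(ℝ, Euc m) ∞ g) {ρ : ℝ} (hρ : 0 < ρ)
    (x : Sph n) : fderiv ℝ (radialExt g) (ρ • (x : Euc (n + 1))) = ρ⁻¹ • sphDeriv g x := by
  have h1 := hasFDerivAt_radialExt hg (smul_sph_ne_zero hρ x)
  have h2 := (HasFDerivAt.comp (f := fun z : Euc (n + 1) => ρ • z) (x : Euc (n + 1)) h1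
    ((hasFDerivAt_id (x : Euc (n + 1))).const_smul ρ)).fderiv
  have h3 : (radialExt g ∘ fun z : Euc (n + 1) => ρ • z) =ᶠ[nhds (x : Euc (n + 1))]
      radialExt g := by
    filter_upwards [isOpen_compl_singleton.mem_nhds (sph_ne_zero x)] with z hz
    have hz' : z ≠ 0 := hz
    simp only [Function.comp_apply]
    rw [← norm_smul_rdir hz', smul_smul, radialExt_smul _ (by positivity),
      radialExt_smul _ (by positivity)]
  rw [sphDeriv, ← h3.fderiv_eq, h2]
  ext1 v
  simp [smul_smul, hρ.ne']

theorem sphDeriv_normal (hg : ContMDiff (𝓡 n) 𝓘(ℝ, Euc m) ∞ g) (x : Sph n) :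
    sphDeriv g x (x : Euc (n + 1)) = 0 := by
  have h1 : HasDerivAt (fun ρ : ℝ => ρ • (x : Euc (n + 1))) (x : Euc (n + 1)) 1 := by
    simpa using (hasDerivAt_id (1 : ℝ)).smul_const (x : Euc (n + 1))
  have h2 := HasFDerivAt.comp_hasDerivAt (f := fun ρ : ℝ => ρ • (x : Euc (n + 1))) 1
    (hasFDerivAt_radialExt hg (smul_sph_ne_zero one_pos x)) h1
  have h3 : (radialExt g ∘ fun ρ : ℝ => ρ • (x : Euc (n + 1))) =ᶠ[nhds 1] fun _ => g x := by
    filter_upwards [Ioi_mem_nhds (zero_lt_one' ℝ)] with ρ hρ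
    exact radialExt_smul g hρ x
  have h4 := h2.unique ((hasDerivAt_const (1 : ℝ) (g x)).congr_of_eventuallyEq h3)
  rw [one_smul] at h4
  exact h4

theorem sphDeriv_smul (hg : ContMDiff (𝓡 n) 𝓘(ℝ, Euc m) ∞ g) {φ : Euc (n + 1) → ℝ}
    (hφ : ContDiff ℝ ∞ φ) (x : Sph n) (v : Euc (n + 1)) :
    sphDeriv (fun z : Sph n => φ (z : Euc (n + 1)) • g z) x v =
      φ (x : Euc (n + 1)) • sphDeriv g x v +
        fderiv ℝ φ (x : Euc (n + 1)) (tangentProj x v) • g x := by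
  have hx : ‖(x : Euc (n + 1))‖⁻¹ • (x : Euc (n + 1)) = x := by simp
  have h1 : HasFDerivAt φ (fderiv ℝ φ (x : Euc (n + 1))) (‖(x : Euc (n + 1))‖⁻¹ •
      (x : Euc (n + 1))) := by
    rw [hx]; exact ((hφ.differentiable (by simp)) _).hasFDerivAt
  have h2 := (HasFDerivAt.comp (f := fun z : Euc (n + 1) => ‖z‖⁻¹ • z) _ h1
    (hasFDerivAt_normalize x)).smul (hasFDerivAt_radialExt hg (sph_ne_zero x))
  have h3 : radialExt (fun z : Sph n => φ (z : Euc (n + 1)) • g z) =ᶠ[nhds (x : Euc (n + 1))]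
      (φ ∘ fun z => ‖z‖⁻¹ • z) • radialExt g := by
    filter_upwards [isOpen_compl_singleton.mem_nhds (sph_ne_zero x)] with z hz
    have hz' : z ≠ 0 := hz
    simp [radialExt_eq _ hz', coe_rdir hz']
  rw [sphDeriv, h3.fderiv_eq, h2.fderiv]
  have hr : radialExt g (x : Euc (n + 1)) = g x := by simpa using radialExt_smul g one_pos x
  simp [hr, sphDeriv, tangentProj, real_inner_comm]

/-- The divergence theorem on the sphere, for the tangential part of a constant vector field. It
follows from `∫ D(χ(|y|) Φ(y)) v dy = 0`, where `Φ` is the radial extension of `g` and `χ` is a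
cutoff, in polar coordinates. -/
theorem integral_sphDeriv (hg : ContMDiff (𝓡 n) 𝓘(ℝ, Euc m) ∞ g) (v : Euc (n + 1)) :
    ∫ x, (sphDeriv g x v - (n * ⟪v, (x : Euc (n + 1))⟫) • g x) ∂(surf n) = 0 := by
  let b : ContDiffBump (1 : ℝ) := ⟨1 / 4, 1 / 2, by norm_num, by norm_num⟩
  let χ : ℝ → ℝ := fun ρ => ρ * b ρ
  have hχ : ContDiff ℝ ∞ χ := contDiff_id.mul b.contDiff
  have hb0 : ∀ ρ : ℝ, ρ < 1 / 2 → b ρ = 0 := fun ρ hρ => b.zero_of_le_dist (by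
    rw [Real.dist_eq, abs_sub_comm]
    exact le_trans (by change (1 / 2 : ℝ) ≤ 1 - ρ; linarith) (le_abs_self _))
  let Ψ : Euc (n + 1) → Euc m := fun y => χ ‖y‖ • radialExt g y
  have hΨ : ContDiff ℝ 1 Ψ := by
    refine contDiff_iff_contDiffAt.2 fun y => ?_
    by_cases hy : y = 0
    · have : Ψ =ᶠ[nhds y] fun _ => 0 := by
        filter_upwards [ball_mem_nhds y (show (0 : ℝ) < 1 / 2 by norm_num)] with z hz
        rw [hy, mem_ball_zero_iff] at hz
        simp [Ψ, χ, hb0 _ hz]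
      exact contDiffAt_const.congr_of_eventuallyEq this
    · exact ContDiffAt.of_le ((hχ.contDiffAt.comp y (contDiffAt_norm ℝ hy)).smul
        (contDiffAt_radialExt hg hy)) (by simp)
  have hcb : HasCompactSupport χ := b.hasCompactSupport.mul_left
  have hc : HasCompactSupport Ψ := by
    refine HasCompactSupport.intro (isCompact_closedBall 0 2) fun y hy => ?_
    have : (2 : ℝ) < ‖y‖ := by simpa using hy
    have : b ‖y‖ = 0 := b.zero_of_le_dist (by
      rw [Real.dist_eq]
      exact le_trans (by change (1 / 2 : ℝ) ≤ ‖y‖ - 1; linarith) (le_abs_self _))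
    simp [Ψ, χ, this]
  have hdi : Integrable fun y => fderiv ℝ Ψ y v :=
    ((hΨ.continuous_fderiv one_ne_zero).clm_apply continuous_const).integrable_of_hasCompactSupport
      (hc.fderiv_apply ℝ v)
  have h0 : ∫ y, fderiv ℝ Ψ y v = 0 := by
    have := integral_smul_fderiv_eq_neg_fderiv_smul_of_integrable (μ := volume)
      (f := fun _ : Euc (n + 1) => (1 : ℝ)) (g := Ψ) (v := v) (by simp) (by simpa using hdi)
      (by simpa using hΨ.continuous.integrable_of_hasCompactSupport hc) (by simp)
      (fun x _ => hΨ.differentiable one_ne_zero x)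
    simpa using this
  rw [integral_polar' hdi] at h0
  have hI := integral_radial_deriv_eq_zero (n := n) (hχ.of_le (by simp)) hcb (by simp [χ])
  have hray : ∀ x : Sph n, (∫ ρ in Ioi (0 : ℝ), ρ ^ n • fderiv ℝ Ψ (ρ • (x : Euc (n + 1))) v) =
      (∫ ρ in Ioi (0 : ℝ), ρ ^ n * b ρ) •
        (sphDeriv g x v - (n * ⟪v, (x : Euc (n + 1))⟫) • g x) := by
    intro x
    have e1 : ∀ ρ ∈ Ioi (0 : ℝ), ρ ^ n • fderiv ℝ Ψ (ρ • (x : Euc (n + 1))) v =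
        (ρ ^ n * (deriv χ ρ + n * ρ⁻¹ * χ ρ)) • (⟪v, (x : Euc (n + 1))⟫ • g x) +
        (ρ ^ n * b ρ) • (sphDeriv g x v - (n * ⟪v, (x : Euc (n + 1))⟫) • g x) := by
      intro ρ hρ
      have hρ0 : ρ ≠ 0 := ne_of_gt hρ
      have hy := smul_sph_ne_zero hρ x
      have h1 := (((hχ.differentiable (by simp)) _).hasDerivAt.comp_hasFDerivAt _
        (hasFDerivAt_norm_euc hy)).smul (hasFDerivAt_radialExt hg hy)
      have h2 : fderiv ℝ Ψ (ρ • (x : Euc (n + 1))) v = χ ρ • ρ⁻¹ • sphDeriv g x v +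
          (deriv χ ρ * ⟪v, (x : Euc (n + 1))⟫) • g x := by
        refine Eq.trans (congrArg (· v) h1.fderiv) ?_
        rw [norm_smul_sph hρ, fderiv_radialExt_smul hg hρ, radialExt_smul g hρ, rdir_smul hρ]
        simp [norm_smul_sph hρ, real_inner_comm]
      rw [h2]
      have h3 : χ ρ = ρ * b ρ := rfl
      have h4 : ρ⁻¹ * (ρ * b ρ) = b ρ := inv_mul_cancel_left₀ hρ0 _
      rw [h3, smul_smul, mul_comm _ ρ⁻¹, h4, mul_assoc (n : ℝ), h4]
      module
    rw [setIntegral_congr_fun measurableSet_Ioi e1, integral_add, integral_smul_const,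
      integral_smul_const, hI, zero_smul, zero_add]
    · refine Integrable.smul_const ?_ _
      have e2 : ∀ ρ ∈ Ioi (0 : ℝ), ρ ^ n * (deriv χ ρ + n * b ρ) =
          ρ ^ n * (deriv χ ρ + n * ρ⁻¹ * χ ρ) := by
        intro ρ hρ
        have hρ0 : ρ ≠ 0 := ne_of_gt hρ
        simp only [χ, mul_assoc, inv_mul_cancel_left₀ hρ0]
      have hcd : HasCompactSupport fun ρ => deriv χ ρ + n * b ρ :=
        hcb.deriv.add b.hasCompactSupport.mul_left
      exact IntegrableOn.congr_fun (((continuous_pow n).mul ((hχ.continuous_deriv (by simp)).add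
        (continuous_const.mul b.continuous))).integrable_of_hasCompactSupport
          hcd.mul_left).integrableOn e2 measurableSet_Ioi
    · refine Integrable.smul_const ?_ _
      exact (((continuous_pow n).mul b.continuous).integrable_of_hasCompactSupport
        b.hasCompactSupport.mul_left).integrableOn
  simp_rw [hray] at h0
  rw [integral_smul, smul_eq_zero] at h0
  refine h0.resolve_left (ne_of_gt ?_)
  have hbi : IntegrableOn (fun ρ : ℝ => ρ ^ n * b ρ) (Ioi 0) :=
    (((continuous_pow n).mul b.continuous).integrable_of_hasCompactSupport
      b.hasCompactSupport.mul_left).integrableOn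
  refine (setIntegral_pos_iff_support_of_nonneg_ae ?_ hbi).2 ?_
  · filter_upwards [ae_restrict_mem measurableSet_Ioi] with ρ hρ
    exact mul_nonneg (pow_nonneg (le_of_lt hρ) n) b.nonneg
  · refine lt_of_lt_of_le ?_ (measure_mono (s := Ioo (3 / 4 : ℝ) 1) fun ρ hρ => ?_)
    · simp; norm_num
    · have h1 : 0 < ρ := by linarith [hρ.1]
      have h2 : b ρ = 1 := b.one_of_mem_closedBall (by
        rw [mem_closedBall, Real.dist_eq, abs_le]
        change -(1 / 4 : ℝ) ≤ ρ - 1 ∧ ρ - 1 ≤ 1 / 4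
        constructor <;> linarith [hρ.1, hρ.2])
      exact ⟨by simp [h2, h1.ne'], h1⟩

theorem hasWeakDeriv_sphDeriv (hg : ContMDiff (𝓡 n) 𝓘(ℝ, Euc m) ∞ g) :
    HasWeakDeriv g (sphDeriv g) := by
  have hi : ∀ {X : Type} [NormedAddCommGroup X] {F : Sph n → X}, Continuous F →
      Integrable F (surf n) := fun hF =>
    hF.integrable_of_hasCompactSupport (HasCompactSupport.of_compactSpace _)
  have hgc := hg.continuous
  have hdc := continuous_sphDeriv hg
  refine ⟨hi hgc, hi hdc, Filter.Eventually.of_forall (sphDeriv_normal hg), fun φ hφ v => ?_⟩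
  have hφg : ContMDiff (𝓡 n) 𝓘(ℝ, Euc m) ∞ fun z : Sph n => φ (z : Euc (n + 1)) • g z := by
    have : Fact (Module.finrank ℝ (Euc (n + 1)) = n + 1) := ⟨finrank_euc n⟩
    exact (hφ.contMDiff.comp contMDiff_coe_sphere).smul hg
  have h0 := integral_sphDeriv hφg v
  simp_rw [sphDeriv_smul hg hφ] at h0
  rw [eq_neg_iff_add_eq_zero, ← integral_add, ← h0]
  · congr 1
    funext x
    module
  · have := hφ.continuous
    exact hi (by fun_prop)
  · have := hφ.continuous
    have h1 : Continuous fun x : Sph n => fderiv ℝ φ (x : Euc (n + 1)) :=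
      (hφ.continuous_fderiv (by simp)).comp continuous_subtype_val
    refine hi ?_
    unfold tangentProj
    fun_prop

theorem HasWeakDeriv.sub {f₁ f₂ : Sph n → Euc m} {G₁ G₂ : Sph n → Euc (n + 1) →L[ℝ] Euc m}
    (h₁ : HasWeakDeriv f₁ G₁) (h₂ : HasWeakDeriv f₂ G₂) : HasWeakDeriv (f₁ - f₂) (G₁ - G₂) := by
  have hb : ∀ {X : Type} [NormedAddCommGroup X] [NormedSpace ℝ X] {F : Sph n → X}
      {κ : Sph n → ℝ}, Integrable F (surf n) → Continuous κ →
      Integrable (fun x => κ x • F x) (surf n) := fun {X} _ _ {F κ} hF hκ => by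
    obtain ⟨K, hK⟩ := (isCompact_univ (X := Sph n)).exists_bound_of_continuousOn hκ.continuousOn
    exact hF.bdd_smul K hκ.aestronglyMeasurable (Filter.Eventually.of_forall fun x => hK x trivial)
  refine ⟨h₁.integrable.sub h₂.integrable, h₁.integrable_deriv.sub h₂.integrable_deriv, ?_,
    fun φ hφ v => ?_⟩
  · filter_upwards [h₁.tangential, h₂.tangential] with x hx₁ hx₂
    simp [hx₁, hx₂]
  · have hc := hφ.continuous
    have hdc : Continuous fun x : Sph n => fderiv ℝ φ (x : Euc (n + 1)) :=
      (hφ.continuous_fderiv (by simp)).comp continuous_subtype_val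
    have hκ : Continuous fun x : Sph n => fderiv ℝ φ (x : Euc (n + 1)) (tangentProj x v)
        - n * ⟪v, (x : Euc (n + 1))⟫ * φ (x : Euc (n + 1)) := by
      unfold tangentProj; fun_prop
    have hφ' : Continuous fun x : Sph n => φ (x : Euc (n + 1)) := by fun_prop
    simp only [Pi.sub_apply, sub_apply, smul_sub]
    rw [integral_sub (hb (h₁.integrable_deriv.apply_continuousLinearMap v) hφ')
      (hb (h₂.integrable_deriv.apply_continuousLinearMap v) hφ'),
      integral_sub (hb h₁.integrable hκ) (hb h₂.integrable hκ),
      h₁.integral_eq φ hφ v, h₂.integral_eq φ hφ v]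
    abel

end Smooth

/-! ### Mollification at a scale that depends on the point -/

/-- A smooth probability density on `ℝ^(n+1)` supported in the ball of radius `1/4`. -/
def mollifier (n : ℕ) : Euc (n + 1) → ℝ :=
  ContDiffBump.normed (⟨1 / 8, 1 / 4, by norm_num, by norm_num⟩ : ContDiffBump (0 : Euc (n + 1)))
    volume

/-- The mollifier rescaled to the ball of radius `s / 4`. -/
def scaledKernel (n : ℕ) (s : ℝ) (x : Euc (n + 1)) : ℝ :=
  s⁻¹ ^ (n + 1) * mollifier n (s⁻¹ • x)

/-- The mollification of the radial extension of `f`, at scale `2 - |y|` at the point `y`. -/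
def mollExt {n m : ℕ} (f : Sph n → Euc m) (y : Euc (n + 1)) : Euc m :=
  ∫ z, mollifier n z • f (rdir (y - (2 - ‖y‖) • z))

variable {n m : ℕ}

theorem contDiff_mollifier : ContDiff ℝ ∞ (mollifier n) :=
  ContDiffBump.contDiff_normed _

theorem mollifier_nonneg (x : Euc (n + 1)) : 0 ≤ mollifier n x := ContDiffBump.nonneg_normed _ x

theorem integrable_mollifier : Integrable (mollifier n) := ContDiffBump.integrable_normed _

theorem integral_mollifier : ∫ x, mollifier n x = 1 := ContDiffBump.integral_normed _

theorem mollifier_eq_zero {x : Euc (n + 1)} (hx : 1 / 4 ≤ ‖x‖) : mollifier n x = 0 := by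
  have := ContDiffBump.support_normed_eq (μ := volume)
    (⟨1 / 8, 1 / 4, by norm_num, by norm_num⟩ : ContDiffBump (0 : Euc (n + 1)))
  by_contra h
  have h2 : x ∈ ball (0 : Euc (n + 1)) (1 / 4) := this ▸ (Function.mem_support.2 h)
  rw [mem_ball_zero_iff] at h2
  linarith

theorem exists_mollifier_le (n : ℕ) : ∃ M : ℝ, 0 < M ∧ ∀ x, mollifier n x ≤ M := by
  have hc : HasCompactSupport (mollifier n) := ContDiffBump.hasCompactSupport_normed _
  obtain ⟨M, hM⟩ := hc.exists_bound_of_continuous contDiff_mollifier.continuous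
  exact ⟨max M 1, by positivity, fun x => (le_abs_self _).trans ((hM x).trans (le_max_left _ _))⟩

theorem scaledKernel_nonneg {s : ℝ} (hs : 0 ≤ s) (x : Euc (n + 1)) : 0 ≤ scaledKernel n s x :=
  mul_nonneg (by positivity) (mollifier_nonneg _)

theorem scaledKernel_eq_zero {s : ℝ} (hs : 0 < s) {x : Euc (n + 1)} (hx : s / 4 ≤ ‖x‖) :
    scaledKernel n s x = 0 := by
  rw [scaledKernel, mollifier_eq_zero, mul_zero]
  rw [norm_smul, norm_inv, Real.norm_of_nonneg hs.le, le_inv_mul_iff₀ hs]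
  linarith

theorem contDiff_scaledKernel (s : ℝ) : ContDiff ℝ ∞ (scaledKernel n s) :=
  contDiff_const.mul (contDiff_mollifier.comp (contDiff_const_smul _))

theorem contDiffOn_scaledKernel :
    ContDiffOn ℝ ∞ (fun p : ℝ × Euc (n + 1) => scaledKernel n p.1 p.2) (Ioi 0 ×ˢ univ) := by
  have hi : ContDiffOn ℝ ∞ (fun p : ℝ × Euc (n + 1) => p.1⁻¹) (Ioi 0 ×ˢ univ) :=
    contDiffOn_fst.inv fun p hp => ne_of_gt hp.1
  exact (hi.pow _).mul (contDiff_mollifier.comp_contDiffOn (hi.smul contDiffOn_snd))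

/-- Since `s ↦ s⁻¹ ^ (n + 1) * η (s⁻¹ • x)` preserves mass, its derivative in the scale is a
divergence, that of `-s⁻¹` times the kernel times the field `x`. -/
theorem fderiv_scaledKernel {s : ℝ} (hs : 0 < s) (x : Euc (n + 1)) (σ : ℝ) (v : Euc (n + 1)) :
    fderiv ℝ (fun p : ℝ × Euc (n + 1) => scaledKernel n p.1 p.2) (s, x) (σ, v) =
      fderiv ℝ (scaledKernel n s) x (v - (σ / s) • x) - σ / s * (n + 1) * scaledKernel n s x := by
  have hs0 : s ≠ 0 := hs.ne'
  have hη : HasFDerivAt (mollifier n) (fderiv ℝ (mollifier n) (s⁻¹ • x)) (s⁻¹ • x) :=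
    ((contDiff_mollifier.differentiable (by simp)) _).hasFDerivAt
  have h1 : HasFDerivAt (𝕜 := ℝ) (scaledKernel n s) _ x :=
    (HasFDerivAt.comp (f := fun x : Euc (n + 1) => s⁻¹ • x) x hη
      ((hasFDerivAt_id x).const_smul s⁻¹)).const_mul (s⁻¹ ^ (n + 1))
  have hi : HasFDerivAt (𝕜 := ℝ) (fun p : ℝ × Euc (n + 1) => p.1⁻¹) _ (s, x) :=
    HasDerivAt.comp_hasFDerivAt (s, x) (hasDerivAt_inv hs0) (hasFDerivAt_fst (𝕜 := ℝ))
  have h2 : HasFDerivAt (𝕜 := ℝ) (fun p : ℝ × Euc (n + 1) => scaledKernel n p.1 p.2) _ (s, x) :=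
    (hi.pow (n + 1)).mul (HasFDerivAt.comp (f := fun p : ℝ × Euc (n + 1) => p.1⁻¹ • p.2) (s, x) hη
      (hi.smul hasFDerivAt_snd))
  rw [h1.fderiv, h2.fderiv]
  simp [scaledKernel]
  field_simp
  ring

theorem mollExt_eq_convolution (f : Sph n → Euc m) {y : Euc (n + 1)} (hy : ‖y‖ < 2) :
    mollExt f y = convolution (fun t : Euc (n + 1) => f (rdir t)) (scaledKernel n (2 - ‖y‖))
      (ContinuousLinearMap.lsmul ℝ ℝ).flip volume y := by
  have hs : 0 < 2 - ‖y‖ := by linarith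
  set s := 2 - ‖y‖ with hs'
  rw [convolution_def, mollExt, ← hs']
  simp only [ContinuousLinearMap.flip_apply, ContinuousLinearMap.lsmul_apply]
  rw [← integral_sub_left_eq_self (fun t => scaledKernel n s (y - t) • f (rdir t)) volume y]
  have h := Measure.integral_comp_smul (volume : Measure (Euc (n + 1)))
    (fun w => scaledKernel n s w • f (rdir (y - w))) s
  simp_rw [sub_sub_cancel]
  rw [finrank_euc, abs_of_nonneg (by positivity), eq_inv_smul_iff₀ (by positivity),
    ← integral_smul] at h
  rw [← h]
  congr 1
  funext z
  rw [scaledKernel, inv_smul_smul₀ hs.ne', smul_smul, ← mul_assoc, inv_pow,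
    mul_inv_cancel₀ (by positivity), one_mul]

theorem contDiffAt_mollExt {f : Sph n → Euc m} (hf : Integrable f (surf n)) {y : Euc (n + 1)}
    (hy : y ≠ 0) (hy2 : ‖y‖ < 2) : ContDiffAt ℝ ∞ (mollExt f) y := by
  have h := contDiffOn_convolution_right_with_param (μ := volume) (n := ⊤)
    (L := (ContinuousLinearMap.lsmul ℝ ℝ).flip)
    (g := scaledKernel n) (s := Ioo 0 2) (k := closedBall 0 1)
    (f := fun t : Euc (n + 1) => f (rdir t)) isOpen_Ioo
    (isCompact_closedBall _ _) (fun p x hp hx => scaledKernel_eq_zero hp.1 (by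
      have : 1 < ‖x‖ := by simpa using hx
      linarith [hp.2]))
    (locallyIntegrable_comp_rdir hf) (contDiffOn_scaledKernel.mono
      (prod_mono Ioo_subset_Ioi_self le_rfl))
  have hy' : 0 < ‖y‖ := norm_pos_iff.2 hy
  have h1 := h.contDiffAt (x := (2 - ‖y‖, y)) ((isOpen_Ioo.prod isOpen_univ).mem_nhds
    ⟨⟨by linarith, by linarith⟩, trivial⟩)
  have h2 : ContDiffAt ℝ ∞ (fun z : Euc (n + 1) => (2 - ‖z‖, z)) y :=
    (contDiffAt_const.sub (contDiffAt_norm ℝ hy)).prodMk contDiffAt_id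
  refine (ContDiffAt.comp (f := fun z : Euc (n + 1) => (2 - ‖z‖, z)) y h1
    h2).congr_of_eventuallyEq ?_
  filter_upwards [(isOpen_lt continuous_norm continuous_const).mem_nhds hy2] with z hz
  exact mollExt_eq_convolution f hz

theorem continuousOn_mollExt {f : Sph n → Euc m} (hf : Continuous f) :
    ContinuousOn (mollExt f) {y | 1 ≤ ‖y‖ ∧ ‖y‖ ≤ 2} := by
  obtain ⟨K, hK⟩ := (isCompact_univ (X := Sph n)).exists_bound_of_continuousOn hf.continuousOn
  refine continuousOn_of_dominated (bound := fun z => mollifier n z * K) (fun y _ => ?_)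
    (fun y _ => Filter.Eventually.of_forall fun z => ?_) (integrable_mollifier.mul_const K)
    (Filter.Eventually.of_forall fun z => ?_)
  · refine Measurable.aestronglyMeasurable ?_
    exact contDiff_mollifier.continuous.measurable.smul
      (hf.measurable.comp (measurable_rdir.comp (by fun_prop)))
  · rw [norm_smul, Real.norm_of_nonneg (mollifier_nonneg z)]
    exact mul_le_mul_of_nonneg_left (hK _ trivial) (mollifier_nonneg z)
  · by_cases hz : 1 / 4 ≤ ‖z‖
    · simp [mollifier_eq_zero hz, continuousOn_const]
    · refine (continuousOn_const (c := mollifier n z)).smul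
        (hf.comp_continuousOn (continuousOn_rdir.comp
        (f := fun y : Euc (n + 1) => y - (2 - ‖y‖) • z) (by fun_prop) ?_))
      intro y hy h0
      have h1 : y = (2 - ‖y‖) • z := sub_eq_zero.1 h0
      have h2 : ‖y‖ = (2 - ‖y‖) * ‖z‖ := by
        conv_lhs => rw [h1, norm_smul, Real.norm_of_nonneg (by linarith [hy.2])]
      nlinarith [hy.1, hy.2, norm_nonneg z]

theorem mollExt_of_norm_eq_two {f : Sph n → Euc m} {y : Euc (n + 1)} (hy : ‖y‖ = 2) :
    mollExt f y = f (rdir y) := by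
  simp [mollExt, hy, integral_smul_const, integral_mollifier]

/-- The weak derivative of the radial extension, tested against the vector field
`k(t) (w + c t)`. -/
theorem HasWeakDeriv.integral_affine_field {f : Sph n → Euc m}
    {G : Sph n → Euc (n + 1) →L[ℝ] Euc m} (h : HasWeakDeriv f G) {k : Euc (n + 1) → ℝ}
    (hk : ContDiff ℝ ∞ k) {a R : ℝ} (ha : 0 < a) (hka : ∀ y, ‖y‖ < a → k y = 0)
    (hkR : ∀ y, R < ‖y‖ → k y = 0) (w : Euc (n + 1)) (c : ℝ) :
    Integrable (fun t => (fderiv ℝ k t (w + c • t) + c * (n + 1) * k t) • f (rdir t) +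
      (‖t‖⁻¹ * k t) • G (rdir t) (w + c • t)) ∧
    ∫ t, ((fderiv ℝ k t (w + c • t) + c * (n + 1) * k t) • f (rdir t) +
      (‖t‖⁻¹ * k t) • G (rdir t) (w + c • t)) = 0 := by
  let ψ : Fin (n + 1) → Euc (n + 1) → ℝ := fun i t => k t * (w i + c * t i)
  let e : Fin (n + 1) → Euc (n + 1) := fun i => EuclideanSpace.single i 1
  have hi (i : Fin (n + 1)) := h.integral_radialExt (ψ := ψ i) (R := R)
    (hk.mul (contDiff_const.add (contDiff_const.mul (by fun_prop)))) ha
    (fun y hy => by simp [ψ, hka y hy]) (fun y hy => by simp [ψ, hkR y hy]) (e i)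
  have hsum : ∀ x : Euc (n + 1), ∑ i, x i • e i = x := fun x => by
    simpa using (EuclideanSpace.basisFun (Fin (n + 1)) ℝ).sum_repr x
  have hd : ∀ i t, fderiv ℝ (ψ i) t (e i) = (w i + c * t i) * fderiv ℝ k t (e i) + c * k t := by
    intro i t
    have h1 : HasFDerivAt (fun t : Euc (n + 1) => t i)
        (EuclideanSpace.proj i : Euc (n + 1) →L[ℝ] ℝ) t :=
      (EuclideanSpace.proj i : Euc (n + 1) →L[ℝ] ℝ).hasFDerivAt
    have h2 := ((hk.differentiable (by simp)) t).hasFDerivAt.mul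
      ((h1.const_mul c).const_add (w i))
    refine (congrArg (· (e i)) h2.fderiv).trans ?_
    simp [e]
    ring
  have key : ∀ t, (fderiv ℝ k t (w + c • t) + c * (n + 1) * k t) • f (rdir t) +
      (‖t‖⁻¹ * k t) • G (rdir t) (w + c • t) = ∑ i, (fderiv ℝ (ψ i) t (e i) • f (rdir t) +
        (‖t‖⁻¹ * ψ i t) • G (rdir t) (e i)) := by
    intro t
    have h1 : fderiv ℝ k t (w + c • t) + c * (n + 1) * k t = ∑ i, fderiv ℝ (ψ i) t (e i) := by
      conv_lhs => rw [← hsum (w + c • t)]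
      simp only [hd, Finset.sum_add_distrib, map_sum, map_smul]
      simp
      ring
    have h2 : (‖t‖⁻¹ * k t) • G (rdir t) (w + c • t) =
        ∑ i, (‖t‖⁻¹ * ψ i t) • G (rdir t) (e i) := by
      conv_lhs => rw [← hsum (w + c • t)]
      simp only [map_sum, map_smul, Finset.smul_sum, smul_smul]
      refine Finset.sum_congr rfl fun i _ => ?_
      simp [ψ, mul_assoc]
    rw [h1, h2, Finset.sum_add_distrib, Finset.sum_smul]
  simp_rw [key]
  refine ⟨integrable_finsetSum _ fun i _ => (hi i).1, ?_⟩
  rw [integral_finsetSum _ fun i _ => (hi i).1]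
  exact Finset.sum_eq_zero fun i _ => (hi i).2

/-- The derivative of the mollification is an average of the weak derivative: differentiating the
kernel in the point and in the scale gives a divergence in the integration variable. -/
theorem HasWeakDeriv.fderiv_mollExt {f : Sph n → Euc m}
    {G : Sph n → Euc (n + 1) →L[ℝ] Euc m} (h : HasWeakDeriv f G) {y : Euc (n + 1)}
    (hy1 : 1 ≤ ‖y‖) (hy2 : ‖y‖ < 2) (v : Euc (n + 1)) :
    fderiv ℝ (mollExt f) y v = ∫ t, (‖t‖⁻¹ * scaledKernel n (2 - ‖y‖) (y - t)) •
      G (rdir t) (v + (⟪(rdir y : Euc (n + 1)), v⟫ / (2 - ‖y‖)) • (y - t)) := by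
  have hy0 : y ≠ 0 := norm_pos_iff.1 (by linarith)
  have hs : 0 < 2 - ‖y‖ := by linarith
  have hs1 : 2 - ‖y‖ ≤ 1 := by linarith
  set s := 2 - ‖y‖ with hs'
  set σ : ℝ := -⟪(rdir y : Euc (n + 1)), v⟫ with hσ
  let L : Euc m →L[ℝ] ℝ →L[ℝ] Euc m := (ContinuousLinearMap.lsmul ℝ ℝ).flip
  let F : Euc (n + 1) → Euc m := fun t => f (rdir t)
  have hF : LocallyIntegrable F := locallyIntegrable_comp_rdir h.integrable
  have hz : ∀ p, ∀ x : Euc (n + 1), p ∈ Ioo (0 : ℝ) 2 → x ∉ closedBall (0 : Euc (n + 1)) 1 →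
      scaledKernel n p x = 0 := fun p x hp hx => scaledKernel_eq_zero hp.1 (by
      have : 1 < ‖x‖ := by simpa using hx
      linarith [hp.2])
  have hsm : ContDiffOn ℝ 1 (Function.HasUncurry.uncurry (scaledKernel n))
      (Ioo (0 : ℝ) 2 ×ˢ univ) :=
    (contDiffOn_scaledKernel.mono (prod_mono Ioo_subset_Ioi_self le_rfl)).of_le (by simp)
  have hU := hasFDerivAt_convolution_right_with_param (μ := volume) (L := L)
    (g := scaledKernel n) (s := Ioo 0 2) (k := closedBall 0 1) (f := F) isOpen_Ioo
    (isCompact_closedBall _ _) hz hF hsm (s, y) ⟨hs, by linarith⟩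
  have h2 : HasFDerivAt (fun z : Euc (n + 1) => (2 - ‖z‖, z)) _ y :=
    ((hasFDerivAt_norm_euc hy0).const_sub 2).prodMk (hasFDerivAt_id y)
  have hW := HasFDerivAt.comp (f := fun z : Euc (n + 1) => (2 - ‖z‖, z)) y hU h2
  have heq : mollExt f =ᶠ[nhds y] (fun q : ℝ × Euc (n + 1) =>
      convolution F (scaledKernel n q.1) L volume q.2) ∘ fun z => (2 - ‖z‖, z) := by
    filter_upwards [(isOpen_lt continuous_norm continuous_const).mem_nhds hy2] with z hz
    exact mollExt_eq_convolution f hz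
  let D : Euc (n + 1) → ℝ × Euc (n + 1) →L[ℝ] ℝ := fun x =>
    fderiv ℝ (fun p : ℝ × Euc (n + 1) => scaledKernel n p.1 p.2) (s, x)
  have hDc : Continuous D := by
    have h3 : ContinuousOn (fderiv ℝ fun p : ℝ × Euc (n + 1) => scaledKernel n p.1 p.2)
        (Ioi 0 ×ˢ univ) :=
      contDiffOn_scaledKernel.continuousOn_fderiv_of_isOpen (isOpen_Ioi.prod isOpen_univ) (by simp)
    exact h3.comp_continuous (by fun_prop) fun x => ⟨hs, trivial⟩
  have hDs : HasCompactSupport D := by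
    refine HasCompactSupport.intro (isCompact_closedBall 0 1) fun x hx => ?_
    have : (fun p : ℝ × Euc (n + 1) => scaledKernel n p.1 p.2) =ᶠ[nhds (s, x)] fun _ => 0 := by
      filter_upwards [(isOpen_Ioo.prod isClosed_closedBall.isOpen_compl).mem_nhds
        (show (s, x) ∈ Ioo (0 : ℝ) 2 ×ˢ (closedBall 0 1)ᶜ from ⟨⟨hs, by linarith⟩, hx⟩)] with p hp
      exact hz p.1 p.2 hp.1 hp.2
    simp only [D]
    rw [this.fderiv_eq]
    simp
  have e1 : fderiv ℝ (mollExt f) y v = ∫ t, D (y - t) (σ, v) • F t := by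
    rw [heq.fderiv_eq, hW.fderiv]
    refine Eq.trans ?_ (convolution_precompR_apply L hF hDs hDc y (σ, v))
    rfl
  have hint : Integrable fun t => D (y - t) (σ, v) • F t :=
    ((hDs.convolutionExists_right (L.precompR (ℝ × Euc (n + 1))) hF hDc
      y).apply_continuousLinearMap (σ, v) :)
  let k : Euc (n + 1) → ℝ := fun t => scaledKernel n s (y - t)
  have hk : ContDiff ℝ ∞ k := (contDiff_scaledKernel s).comp (contDiff_const.sub contDiff_id)
  have hk0 : ∀ t, s / 4 ≤ ‖y - t‖ → k t = 0 := fun t ht => scaledKernel_eq_zero hs ht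
  have hfield := h.integral_affine_field hk (a := 1 / 2) (R := 4) (by norm_num)
    (fun t ht => hk0 t (by linarith [norm_sub_norm_le y t]))
    (fun t ht => hk0 t (by linarith [norm_sub_norm_le t y, norm_sub_rev t y]))
    (v - (σ / s) • y) (σ / s)
  have hζ : ∀ t, v - (σ / s) • y + (σ / s) • t = v - (σ / s) • (y - t) := fun t => by module
  have hdk : ∀ t u, fderiv ℝ k t u = - fderiv ℝ (scaledKernel n s) (y - t) u := by
    intro t u
    have h3 := HasFDerivAt.comp (f := fun t : Euc (n + 1) => y - t) t
      (((contDiff_scaledKernel (n := n) s).differentiable (by simp)) (y - t)).hasFDerivAt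
      ((hasFDerivAt_id t).const_sub y)
    refine (congrArg (· u) h3.fderiv).trans ?_
    simp
  have hpt : ∀ t, (‖t‖⁻¹ * k t) • G (rdir t) (v - (σ / s) • (y - t)) =
      ((fderiv ℝ k t (v - (σ / s) • y + (σ / s) • t) + σ / s * (n + 1) * k t) • f (rdir t) +
      (‖t‖⁻¹ * k t) • G (rdir t) (v - (σ / s) • y + (σ / s) • t)) + D (y - t) (σ, v) • F t := by
    intro t
    simp only [D]
    rw [fderiv_scaledKernel hs, hζ, hdk]
    simp only [F, k]
    module
  have hneg : ⟪(rdir y : Euc (n + 1)), v⟫ / s = - (σ / s) := by rw [hσ]; ring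
  simp only [hneg, neg_smul, ← sub_eq_add_neg]
  rw [e1, ← zero_add (∫ t, D (y - t) (σ, v) • F t), ← hfield.2, ← integral_add hfield.1 hint]
  exact (integral_congr_ae (Filter.Eventually.of_forall hpt)).symm

/-! ### Averages of functions on the sphere -/

/-- The mollification, at scale `2 - |y|` at the point `y`, of the `0`-homogeneous extension of a
nonnegative function on the sphere. -/
def localAvg (h : Sph n → ℝ≥0∞) (y : Euc (n + 1)) : ℝ≥0∞ :=
  ∫⁻ t, ENNReal.ofReal (scaledKernel n (2 - ‖y‖) (y - t)) * h (rdir t)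

theorem enorm_mollExt_le (f : Sph n → Euc m) {y : Euc (n + 1)} (hy : ‖y‖ < 2) :
    ‖mollExt f y‖ₑ ≤ localAvg (fun x => ‖f x‖ₑ) y := by
  rw [mollExt_eq_convolution f hy, convolution_def]
  refine (enorm_integral_le_lintegral_enorm _).trans (lintegral_mono fun t => ?_)
  simp only [ContinuousLinearMap.flip_apply, ContinuousLinearMap.lsmul_apply, enorm_smul]
  rw [Real.enorm_of_nonneg (scaledKernel_nonneg (by linarith) _)]

theorem HasWeakDeriv.enorm_fderiv_mollExt_le {f : Sph n → Euc m}
    {G : Sph n → Euc (n + 1) →L[ℝ] Euc m} (h : HasWeakDeriv f G) {y : Euc (n + 1)}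
    (hy1 : 1 ≤ ‖y‖) (hy2 : ‖y‖ < 2) :
    ‖fderiv ℝ (mollExt f) y‖ₑ ≤ 4 * localAvg (fun x => ‖G x‖ₑ) y := by
  have hs : 0 < 2 - ‖y‖ := by linarith
  have key : ∀ v, ‖fderiv ℝ (mollExt f) y v‖ₑ ≤ 4 * localAvg (fun x => ‖G x‖ₑ) y * ‖v‖ₑ := by
    intro v
    rw [h.fderiv_mollExt hy1 hy2 v]
    refine (enorm_integral_le_lintegral_enorm _).trans ?_
    rw [mul_comm, ← mul_assoc, localAvg, ← lintegral_const_mul' _ _ (by finiteness)]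
    refine lintegral_mono fun t => ?_
    by_cases hk : (2 - ‖y‖) / 4 ≤ ‖y - t‖
    · simp [scaledKernel_eq_zero hs hk]
    have hk' := not_le.1 hk
    have ht : 1 / 2 ≤ ‖t‖ := by linarith [norm_sub_norm_le y t]
    have hti : ‖t‖⁻¹ ≤ 2 := by
      rw [inv_le_comm₀ (by linarith) two_pos]; linarith
    have hin : |⟪(rdir y : Euc (n + 1)), v⟫| ≤ ‖v‖ := by
      simpa using abs_real_inner_le_norm (rdir y : Euc (n + 1)) v
    have hv : ‖v + (⟪(rdir y : Euc (n + 1)), v⟫ / (2 - ‖y‖)) • (y - t)‖ ≤ 2 * ‖v‖ := by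
      refine (norm_add_le _ _).trans ?_
      have : ‖(⟪(rdir y : Euc (n + 1)), v⟫ / (2 - ‖y‖)) • (y - t)‖ ≤ ‖v‖ := by
        rw [norm_smul, norm_div, Real.norm_of_nonneg hs.le, Real.norm_eq_abs, div_mul_eq_mul_div,
          div_le_iff₀ hs]
        exact mul_le_mul hin (by linarith) (norm_nonneg _) (norm_nonneg _)
      linarith
    have hkn := scaledKernel_nonneg hs.le (y - t)
    rw [enorm_smul, Real.enorm_of_nonneg (by positivity)]
    calc ENNReal.ofReal (‖t‖⁻¹ * scaledKernel n (2 - ‖y‖) (y - t)) *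
          ‖G (rdir t) (v + (⟪(rdir y : Euc (n + 1)), v⟫ / (2 - ‖y‖)) • (y - t))‖ₑ
        ≤ ENNReal.ofReal (2 * scaledKernel n (2 - ‖y‖) (y - t)) *
          ENNReal.ofReal (‖G (rdir t)‖ * (2 * ‖v‖)) := by
          gcongr
          rw [← ofReal_norm]
          refine ENNReal.ofReal_le_ofReal ((G (rdir t)).le_opNorm _ |>.trans ?_)
          gcongr
      _ = _ := by
          rw [← ofReal_norm v, ← ofReal_norm (G (rdir t)),
            show (4 : ℝ≥0∞) = ENNReal.ofReal 4 by simp, ← ENNReal.ofReal_mul (by positivity),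
            ← ENNReal.ofReal_mul (by positivity), ← ENNReal.ofReal_mul (by positivity),
            ← ENNReal.ofReal_mul (by positivity)]
          congr 1
          ring
  by_cases hA : localAvg (fun x => ‖G x‖ₑ) y = ⊤
  · rw [hA]; simp
  have hc : (4 * localAvg (fun x => ‖G x‖ₑ) y) ≠ ⊤ := by finiteness
  rw [← ENNReal.coe_toNNReal hc, enorm_le_coe]
  refine ContinuousLinearMap.opNNNorm_le_bound _ _ fun v => ?_
  have := key v
  rw [← ENNReal.coe_toNNReal hc] at this
  simpa only [enorm_eq_nnnorm, ← ENNReal.coe_mul, ENNReal.coe_le_coe] using this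

theorem measurable_scaledKernel :
    Measurable fun p : Euc (n + 1) × Euc (n + 1) =>
      ENNReal.ofReal (scaledKernel n (2 - ‖p.1‖) (p.1 - p.2)) := by
  refine Measurable.ennreal_ofReal ?_
  unfold scaledKernel
  exact (by fun_prop : Measurable fun p : Euc (n + 1) × Euc (n + 1) =>
    (2 - ‖p.1‖)⁻¹ ^ (n + 1)).mul (contDiff_mollifier.continuous.measurable.comp (by fun_prop))

theorem localAvg_congr {h h' : Sph n → ℝ≥0∞} (hh : h =ᵐ[surf n] h') :
    localAvg h = localAvg h' := by
  funext y
  refine lintegral_congr_ae ?_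
  filter_upwards [(quasiMeasurePreserving_rdir n).ae_eq hh] with t ht
  simp only [Function.comp_apply] at ht
  rw [ht]

theorem measurable_localAvg {h : Sph n → ℝ≥0∞} (hh : Measurable h) : Measurable (localAvg h) :=
  Measurable.lintegral_prod_right'
    (f := fun p : Euc (n + 1) × Euc (n + 1) =>
      ENNReal.ofReal (scaledKernel n (2 - ‖p.1‖) (p.1 - p.2)) * h (rdir p.2))
    (measurable_scaledKernel.mul (hh.comp (measurable_rdir.comp measurable_snd)))

theorem lintegral_scaledKernel {y : Euc (n + 1)} (hy : ‖y‖ < 2) :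
    ∫⁻ t, ENNReal.ofReal (scaledKernel n (2 - ‖y‖) (y - t)) = 1 := by
  have hs : 0 < 2 - ‖y‖ := by linarith
  rw [lintegral_sub_left_eq_self (fun x => ENNReal.ofReal (scaledKernel n (2 - ‖y‖) x)) y]
  have h := Measure.integral_comp_inv_smul_of_nonneg (volume : Measure (Euc (n + 1)))
    (mollifier n) hs.le
  rw [integral_mollifier, finrank_euc, smul_eq_mul, mul_one] at h
  have hi : Integrable (scaledKernel n (2 - ‖y‖)) := by
    have h1 : Integrable fun x : Euc (n + 1) => mollifier n ((2 - ‖y‖)⁻¹ • x) := by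
      exact Integrable.comp_smul (f := mollifier n) integrable_mollifier (inv_ne_zero hs.ne')
    exact h1.const_mul ((2 - ‖y‖)⁻¹ ^ (n + 1))
  rw [← ofReal_integral_eq_lintegral_ofReal hi
    (Filter.Eventually.of_forall (scaledKernel_nonneg hs.le))]
  unfold scaledKernel
  rw [integral_const_mul, h, inv_pow, inv_mul_cancel₀ (by positivity), ENNReal.ofReal_one]

/-- **Jensen's inequality** for the local averages. -/
theorem localAvg_pow_le (hn : 2 ≤ n) {h : Sph n → ℝ≥0∞} (hh : Measurable h) {y : Euc (n + 1)}
    (hy : ‖y‖ < 2) : localAvg h y ^ n ≤ localAvg (fun x => h x ^ n) y := by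
  have hmk : Measurable fun t => ENNReal.ofReal (scaledKernel n (2 - ‖y‖) (y - t)) :=
    Measurable.ennreal_ofReal ((contDiff_scaledKernel (2 - ‖y‖)).continuous.comp
      (continuous_const.sub continuous_id)).measurable
  let μ := (volume : Measure (Euc (n + 1))).withDensity
    fun t => ENNReal.ofReal (scaledKernel n (2 - ‖y‖) (y - t))
  have hμ : ∀ {F : Euc (n + 1) → ℝ≥0∞}, Measurable F → ∫⁻ t, F t ∂μ =
      ∫⁻ t, ENNReal.ofReal (scaledKernel n (2 - ‖y‖) (y - t)) * F t := fun hF =>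
    lintegral_withDensity_eq_lintegral_mul _ hmk hF
  have hμ1 : μ univ = 1 := by
    rw [withDensity_apply _ MeasurableSet.univ, setLIntegral_univ, lintegral_scaledKernel hy]
  have hm : Measurable fun t : Euc (n + 1) => h (rdir t) := hh.comp measurable_rdir
  have hn1 : (1 : ℝ) < n := by exact_mod_cast hn
  have := ENNReal.lintegral_mul_le_Lp_mul_Lq μ (Real.HolderConjugate.conjExponent hn1)
    hm.aemeasurable (measurable_one (α := ℝ≥0∞)).aemeasurable
  simp only [Pi.mul_apply, Pi.one_apply, mul_one, ENNReal.one_rpow, lintegral_one, hμ1,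
    ENNReal.rpow_natCast] at this
  rw [hμ hm, hμ (hm.pow_const n)] at this
  calc localAvg h y ^ n ≤ (localAvg (fun x => h x ^ n) y ^ (1 / (n : ℝ))) ^ n := by
        gcongr
        exact this
    _ = _ := by
      rw [← ENNReal.rpow_natCast, ← ENNReal.rpow_mul, one_div_mul_cancel (by positivity),
        ENNReal.rpow_one]

/-! ### The critical embedding -/

/-- Each local average is at most a constant multiple of `‖h‖_{L^n}` divided by the scale. -/
theorem exists_localAvg_le (hn : 2 ≤ n) : ∃ N : ℝ≥0, ∀ h : Sph n → ℝ≥0∞, Measurable h →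
    ∀ y : Euc (n + 1), ‖y‖ < 2 →
      localAvg h y ≤ N * (∫⁻ x, h x ^ n ∂(surf n)) ^ (1 / (n : ℝ)) / ENNReal.ofReal (2 - ‖y‖) := by
  obtain ⟨M, hM, hMle⟩ := exists_mollifier_le n
  refine ⟨((M * 2 ^ n).toNNReal) ^ (1 / (n : ℝ)), fun h hh y hy => ?_⟩
  have hs : 0 < 2 - ‖y‖ := by linarith
  set s := 2 - ‖y‖ with hs'
  have hn0 : (0 : ℝ) < n := by positivity
  set B := ∫⁻ x, h x ^ n ∂(surf n) with hB
  let I : Set ℝ := Ioo (‖y‖ - s / 4) (‖y‖ + s / 4)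
  have h1 : localAvg (fun x => h x ^ n) y ≤
      ENNReal.ofReal (s⁻¹ ^ (n + 1) * M) * ((∫⁻ ρ in Ioi (0 : ℝ), ENNReal.ofReal (ρ ^ n) *
        I.indicator 1 ρ) * B) := by
    rw [hB, ← lintegral_radial_mul (measurable_one.indicator measurableSet_Ioo)
      (hh.pow_const n).aemeasurable, ← lintegral_const_mul' _ _ (by finiteness)]
    refine lintegral_mono fun t => ?_
    by_cases ht : s / 4 ≤ ‖y - t‖
    · simp [← hs', scaledKernel_eq_zero hs ht]
    · have ht' := not_le.1 ht
      have hI : ‖t‖ ∈ I := by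
        constructor
        · linarith [norm_sub_norm_le y t]
        · linarith [norm_sub_norm_le t y, norm_sub_rev t y]
      rw [indicator_of_mem hI, Pi.one_apply, one_mul, ← hs']
      gcongr
      exact mul_le_mul_of_nonneg_left (hMle _) (by positivity)
  have h2 : ∫⁻ ρ in Ioi (0 : ℝ), ENNReal.ofReal (ρ ^ n) * I.indicator 1 ρ ≤
      ENNReal.ofReal (2 ^ n * s) := by
    calc ∫⁻ ρ in Ioi (0 : ℝ), ENNReal.ofReal (ρ ^ n) * I.indicator 1 ρ
        ≤ ∫⁻ ρ in Ioi (0 : ℝ), I.indicator (fun _ => ENNReal.ofReal (2 ^ n)) ρ := by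
          refine setLIntegral_mono' measurableSet_Ioi fun ρ hρ => ?_
          by_cases h : ρ ∈ I
          · rw [indicator_of_mem h, indicator_of_mem h, Pi.one_apply, mul_one]
            exact ENNReal.ofReal_le_ofReal (pow_le_pow_left₀ (le_of_lt hρ) (by linarith [h.2]) n)
          · rw [indicator_of_notMem h, mul_zero]; exact zero_le
      _ ≤ ∫⁻ ρ, I.indicator (fun _ => ENNReal.ofReal (2 ^ n)) ρ := setLIntegral_le_lintegral _ _
      _ = ENNReal.ofReal (2 ^ n) * ENNReal.ofReal (‖y‖ + s / 4 - (‖y‖ - s / 4)) := by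
          rw [lintegral_indicator_const measurableSet_Ioo, Real.volume_Ioo]
      _ ≤ ENNReal.ofReal (2 ^ n * s) := by
          rw [← ENNReal.ofReal_mul (by positivity)]
          gcongr
          linarith
  have h3 : localAvg h y ^ n ≤ ENNReal.ofReal (M * 2 ^ n) * B / ENNReal.ofReal s ^ n := by
    refine (localAvg_pow_le hn hh hy).trans (h1.trans ?_)
    calc ENNReal.ofReal (s⁻¹ ^ (n + 1) * M) * ((∫⁻ ρ in Ioi (0 : ℝ), ENNReal.ofReal (ρ ^ n) *
        I.indicator 1 ρ) * B)
        ≤ ENNReal.ofReal (s⁻¹ ^ (n + 1) * M) * (ENNReal.ofReal (2 ^ n * s) * B) := by gcongr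
      _ = ENNReal.ofReal (M * 2 ^ n / s ^ n) * B := by
          rw [← mul_assoc, ← ENNReal.ofReal_mul (by positivity)]
          congr 2
          rw [inv_pow, pow_succ]
          field_simp
      _ = _ := by
          rw [ENNReal.ofReal_div_of_pos (by positivity), ENNReal.ofReal_pow hs.le,
            ENNReal.mul_div_right_comm]
  have h4 := ENNReal.rpow_le_rpow h3 (z := 1 / (n : ℝ)) (by positivity)
  rw [ENNReal.div_rpow_of_nonneg _ _ (by positivity),
    ENNReal.mul_rpow_of_nonneg _ _ (by positivity),
    ← ENNReal.rpow_natCast, ← ENNReal.rpow_natCast, ← ENNReal.rpow_mul, ← ENNReal.rpow_mul,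
    mul_one_div_cancel hn0.ne', ENNReal.rpow_one, ENNReal.rpow_one] at h4
  rw [ENNReal.coe_rpow_of_nonneg _ (by positivity)]
  exact h4

/-- `∫₀^∞ min(a, b/r)^n dr ≤ 2 a^(n-1) b` for `n ≥ 2`. -/
theorem lintegral_min_div_pow_le (hn : 2 ≤ n) (a b : ℝ≥0∞) :
    ∫⁻ r in Ioi (0 : ℝ), (min a (b / ENNReal.ofReal r)) ^ n ≤ 2 * a ^ (n - 1) * b := by
  have hn1 : n ≠ 0 := by omega
  have hn2 : n - 1 ≠ 0 := by omega
  rcases eq_or_ne a 0 with rfl | ha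
  · simp [hn1]
  rcases eq_or_ne b 0 with rfl | hb
  · simp [hn1]
  rcases eq_or_ne a ⊤ with rfl | ha'
  · rw [ENNReal.top_pow hn2]; simp [hb]
  rcases eq_or_ne b ⊤ with rfl | hb'
  · rw [ENNReal.mul_top (by positivity)]; exact le_top
  lift a to ℝ≥0 using ha'
  lift b to ℝ≥0 using hb'
  have ha0 : (0 : ℝ) < a := by
    have : a ≠ 0 := by exact_mod_cast ha
    positivity
  have hb0 : (0 : ℝ) < b := by
    have : b ≠ 0 := by exact_mod_cast hb
    positivity
  have hr0 : (0 : ℝ) < b / a := by positivity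
  have hA : (a : ℝ≥0∞) = ENNReal.ofReal a := by simp
  have hBb : (b : ℝ≥0∞) = ENNReal.ofReal b := by simp
  rw [← Ioc_union_Ioi_eq_Ioi hr0.le, lintegral_union measurableSet_Ioi
    (Set.disjoint_left.2 fun x hx hx' => not_lt.2 hx.2 hx')]
  have h1 : ∫⁻ r in Ioc (0 : ℝ) (b / a), (min (a : ℝ≥0∞) (b / ENNReal.ofReal r)) ^ n ≤
      (a : ℝ≥0∞) ^ (n - 1) * b := by
    calc ∫⁻ r in Ioc (0 : ℝ) (b / a), (min (a : ℝ≥0∞) (b / ENNReal.ofReal r)) ^ n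
        ≤ ∫⁻ r in Ioc (0 : ℝ) (b / a), (a : ℝ≥0∞) ^ n := by
          refine lintegral_mono fun r => ?_
          gcongr
          exact min_le_left _ _
      _ = (a : ℝ≥0∞) ^ (n - 1) * b := by
          rw [setLIntegral_const, Real.volume_Ioc, hA, hBb, ← ENNReal.ofReal_pow ha0.le,
            ← ENNReal.ofReal_pow ha0.le, ← ENNReal.ofReal_mul (by positivity),
            ← ENNReal.ofReal_mul (by positivity)]
          congr 1
          obtain ⟨k, rfl⟩ := Nat.exists_eq_succ_of_ne_zero hn1
          simp only [Nat.succ_eq_add_one, Nat.add_sub_cancel]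
          field_simp
          ring
  have h2 : ∫⁻ r in Ioi ((b : ℝ) / a), (min (a : ℝ≥0∞) (b / ENNReal.ofReal r)) ^ n ≤
      (a : ℝ≥0∞) ^ (n - 1) * b := by
    have hlt : -(n : ℝ) < -1 := by
      have : (2 : ℝ) ≤ n := by exact_mod_cast hn
      linarith
    calc ∫⁻ r in Ioi ((b : ℝ) / a), (min (a : ℝ≥0∞) (b / ENNReal.ofReal r)) ^ n
        ≤ ∫⁻ r in Ioi ((b : ℝ) / a), ENNReal.ofReal (b ^ n * r ^ (-(n : ℝ))) := by
          refine setLIntegral_mono' measurableSet_Ioi fun r hr => ?_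
          have hr' : 0 < r := hr0.trans hr
          refine (pow_le_pow_left' (min_le_right _ _) n).trans ?_
          rw [hBb, ← ENNReal.ofReal_div_of_pos hr', ← ENNReal.ofReal_pow (by positivity)]
          refine ENNReal.ofReal_le_ofReal (le_of_eq ?_)
          rw [Real.rpow_neg hr'.le, Real.rpow_natCast, div_pow, div_eq_mul_inv]
      _ = ENNReal.ofReal (b ^ n * (-((b : ℝ) / a) ^ (-(n : ℝ) + 1) / (-(n : ℝ) + 1))) := by
          rw [← ofReal_integral_eq_lintegral_ofReal
            ((integrableOn_Ioi_rpow_of_lt hlt hr0).const_mul _), integral_const_mul,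
            integral_Ioi_rpow_of_lt hlt hr0]
          filter_upwards [ae_restrict_mem measurableSet_Ioi] with r hr
          have hr' : 0 < r := hr0.trans hr
          positivity
      _ ≤ (a : ℝ≥0∞) ^ (n - 1) * b := by
          rw [hA, hBb, ← ENNReal.ofReal_pow ha0.le, ← ENNReal.ofReal_mul (by positivity)]
          refine ENNReal.ofReal_le_ofReal ?_
          obtain ⟨k, rfl⟩ := Nat.exists_eq_succ_of_ne_zero hn1
          have hk : (1 : ℝ) ≤ k := by
            have : 1 ≤ k := by omega
            exact_mod_cast this
          simp only [Nat.succ_eq_add_one, Nat.add_sub_cancel]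
          have e1 : -((k + 1 : ℕ) : ℝ) + 1 = -(k : ℝ) := by push_cast; ring
          rw [e1, Real.rpow_neg hr0.le, Real.rpow_natCast, neg_div_neg_eq, div_pow, inv_div]
          have e2 : (b : ℝ) ^ (k + 1) * ((a : ℝ) ^ k / (b : ℝ) ^ k / k) = (a : ℝ) ^ k * b / k := by
            field_simp
            ring
          rw [e2]
          exact div_le_self (by positivity) hk
  calc _ ≤ (a : ℝ≥0∞) ^ (n - 1) * b + (a : ℝ≥0∞) ^ (n - 1) * b := add_le_add h1 h2
    _ = _ := by ring

/-- The part of the average over points where `h` is at least half the average already accounts for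
half of the average. -/
theorem localAvg_le_two_mul (h : Sph n → ℝ≥0∞) {y : Euc (n + 1)}
    (hy : ‖y‖ < 2) (hA : localAvg h y ≠ ⊤) :
    localAvg h y ≤ 2 * ∫⁻ t, ENNReal.ofReal (scaledKernel n (2 - ‖y‖) (y - t)) *
      {t | localAvg h y ≤ 2 * h (rdir t)}.indicator (fun t => h (rdir t)) t := by
  set A := localAvg h y with hAdef
  have hmk : Measurable fun t => ENNReal.ofReal (scaledKernel n (2 - ‖y‖) (y - t)) :=
    Measurable.ennreal_ofReal ((contDiff_scaledKernel (2 - ‖y‖)).continuous.comp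
      (continuous_const.sub continuous_id)).measurable
  have h1 : A ≤ (∫⁻ t, ENNReal.ofReal (scaledKernel n (2 - ‖y‖) (y - t)) *
      {t | A ≤ 2 * h (rdir t)}.indicator (fun t => h (rdir t)) t) + A / 2 := by
    calc A ≤ ∫⁻ t, (ENNReal.ofReal (scaledKernel n (2 - ‖y‖) (y - t)) *
          {t | A ≤ 2 * h (rdir t)}.indicator (fun t => h (rdir t)) t +
          ENNReal.ofReal (scaledKernel n (2 - ‖y‖) (y - t)) * (A / 2)) := by
          rw [hAdef]
          nth_rw 1 [localAvg]
          refine lintegral_mono fun t => ?_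
          rw [← mul_add]
          gcongr
          by_cases ht : A ≤ 2 * h (rdir t)
          · rw [indicator_of_mem (by exact ht)]; exact le_self_add
          · rw [indicator_of_notMem (by exact ht), zero_add,
              ENNReal.le_div_iff_mul_le (by simp) (by simp), mul_comm]
            exact (not_le.1 ht).le
      _ = _ := by
          rw [lintegral_add_right _ (hmk.mul_const _), lintegral_mul_const _ hmk,
            lintegral_scaledKernel hy, one_mul]
  have h2 : A / 2 ≠ ⊤ := (ENNReal.div_lt_top hA (by simp)).ne
  have h3 : A / 2 ≤ ∫⁻ t, ENNReal.ofReal (scaledKernel n (2 - ‖y‖) (y - t)) *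
      {t | A ≤ 2 * h (rdir t)}.indicator (fun t => h (rdir t)) t := by
    refine (ENNReal.add_le_add_iff_right h2).1 ?_
    rwa [ENNReal.add_halves]
  calc A = 2 * (A / 2) := (ENNReal.mul_div_cancel (by simp) (by simp)).symm
    _ ≤ _ := by gcongr

/-- The kernel, seen as a function of its first argument, is concentrated where the two scales are
comparable. -/
theorem scaledKernel_le_of_ne_zero {M : ℝ} (hM : ∀ x, mollifier n x ≤ M) {y t : Euc (n + 1)}
    (hy : ‖y‖ < 2) (hk : scaledKernel n (2 - ‖y‖) (y - t) ≠ 0) :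
    0 < 2 - ‖t‖ ∧ 2 - ‖t‖ ≤ 2 * (2 - ‖y‖) ∧ y ∈ ball t (2 - ‖t‖) ∧
      scaledKernel n (2 - ‖y‖) (y - t) ≤ (2 / (2 - ‖t‖)) ^ (n + 1) * M := by
  have hs : 0 < 2 - ‖y‖ := by linarith
  have h1 : ‖y - t‖ < (2 - ‖y‖) / 4 := not_le.1 fun h => hk (scaledKernel_eq_zero hs h)
  have h2 := norm_sub_norm_le y t
  have h3 : ‖t‖ - ‖y‖ ≤ ‖y - t‖ := by rw [norm_sub_rev]; exact norm_sub_norm_le t y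
  have ht : 0 < 2 - ‖t‖ := by linarith
  refine ⟨ht, by linarith, by rw [mem_ball, dist_eq_norm]; linarith, ?_⟩
  have hM0 : 0 ≤ M := (mollifier_nonneg 0).trans (hM 0)
  refine mul_le_mul (pow_le_pow_left₀ (by positivity) ?_ _) (hM _) (mollifier_nonneg _)
    (by positivity)
  rw [inv_le_comm₀ hs (by positivity), inv_div]
  linarith

/-- The critical embedding: the `L^(n+1)` norm of the local averages on the shell `1 ≤ |y| < 2` is
controlled by the `L^n` norm on the sphere. In the integral of `A^(n+1)`, one factor `A` is replaced
by an average of `h` over points where `A ≤ 2 h`, and the others are estimated by the minimum of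
`2 h` and `‖h‖_{L^n}` divided by the scale. Integrating first over the point at which the average is
taken leaves a one-dimensional integral in the scale. -/
theorem exists_lintegral_localAvg_pow_le (hn : 2 ≤ n) : ∃ C : ℝ≥0, ∀ h : Sph n → ℝ≥0∞,
    Measurable h → ∫⁻ y in {y : Euc (n + 1) | 1 ≤ ‖y‖ ∧ ‖y‖ < 2}, localAvg h y ^ (n + 1) ≤
      C * ((∫⁻ x, h x ^ n ∂(surf n)) ^ (1 / (n : ℝ))) ^ (n + 1) := by
  obtain ⟨N, hN⟩ := exists_localAvg_le hn
  obtain ⟨M, hM, hMle⟩ := exists_mollifier_le n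
  have hn0 : n ≠ 0 := by omega
  let V : ℝ≥0∞ := volume (ball (0 : Euc (n + 1)) 1)
  have hV : V ≠ ⊤ := measure_ball_lt_top.ne
  let c : ℝ≥0 := 2 * (((2 : ℝ≥0) ^ (n + 1) * M.toNNReal) * V.toNNReal)
  refine ⟨c * 2 ^ n * (2 * 2 ^ (n - 1) * (2 * N)) + 1, fun h hh => ?_⟩
  set B := ∫⁻ x, h x ^ n ∂(surf n) with hB
  set b := B ^ (1 / (n : ℝ)) with hb
  have hbn : b ^ n = B := by
    rw [hb, ← ENNReal.rpow_natCast, ← ENNReal.rpow_mul, one_div_mul_cancel (by positivity),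
      ENNReal.rpow_one]
  rcases eq_or_ne b ⊤ with hbt | hbt
  · rw [hbt, ENNReal.top_pow (by omega), ENNReal.mul_top]
    · exact le_top
    · simp
  set S := {y : Euc (n + 1) | 1 ≤ ‖y‖ ∧ ‖y‖ < 2} with hS
  have hSm : MeasurableSet S :=
    (measurableSet_le measurable_const measurable_norm).inter
      (measurableSet_lt measurable_norm measurable_const)
  let A := localAvg h
  have hhm : Measurable fun t : Euc (n + 1) => h (rdir t) := hh.comp measurable_rdir
  let K : Euc (n + 1) → Euc (n + 1) → ℝ≥0∞ := fun y t =>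
    ENNReal.ofReal (scaledKernel n (2 - ‖y‖) (y - t))
  let β : ℝ≥0∞ := 2 * N * b
  -- the bound for the average in terms of the scale at the integration variable
  let q : Sph n → ℝ → ℝ≥0∞ := fun x s => min (2 * h x) (β / ENNReal.ofReal s)
  have hAfin : ∀ y ∈ S, A y ≠ ⊤ := fun y hy => by
    refine ne_top_of_le_ne_top ?_ (hN h hh y hy.2)
    have : 0 < 2 - ‖y‖ := by linarith [hy.2]
    refine (ENNReal.div_lt_top (by finiteness) ?_).ne
    simpa using this
  -- One factor is replaced by the average over the points where `A y ≤ 2 h`.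
  have pow_le_restricted : ∀ y ∈ S, A y ^ (n + 1) ≤ 2 * ∫⁻ t, K y t *
      ({t | A y ≤ 2 * h (rdir t)}.indicator (fun t => h (rdir t)) t * A y ^ n) := by
    intro y hy
    have h1 := localAvg_le_two_mul h hy.2 (hAfin y hy)
    calc A y ^ (n + 1) = A y * A y ^ n := by rw [pow_succ, mul_comm]
      _ ≤ (2 * ∫⁻ t, K y t * {t | A y ≤ 2 * h (rdir t)}.indicator (fun t => h (rdir t)) t) *
          A y ^ n := by gcongr
      _ = _ := by
          rw [mul_assoc, ← lintegral_mul_const' _ _ (ENNReal.pow_ne_top (hAfin y hy))]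
          simp_rw [mul_assoc]
  -- On the support of the kernel the scales at `y` and at `t` are comparable, so the remaining
  -- factors and the kernel are bounded in terms of `t` alone.
  have integrand_le : ∀ y ∈ S, ∀ t, K y t *
      ({t | A y ≤ 2 * h (rdir t)}.indicator (fun t => h (rdir t)) t * A y ^ n) ≤
      (ball (0 : Euc (n + 1)) 2).indicator (fun t => h (rdir t) * q (rdir t) (2 - ‖t‖) ^ n *
        ENNReal.ofReal ((2 / (2 - ‖t‖)) ^ (n + 1) * M)) t * (ball t (2 - ‖t‖)).indicator 1 y := by
    intro y hy t
    by_cases hk : scaledKernel n (2 - ‖y‖) (y - t) = 0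
    · simp [K, hk]
    by_cases hle : A y ≤ 2 * h (rdir t)
    swap
    · rw [indicator_of_notMem (by exact hle)]; simp
    obtain ⟨ht, hts, hball, hkle⟩ := scaledKernel_le_of_ne_zero hMle hy.2 hk
    rw [indicator_of_mem (by exact hle), indicator_of_mem hball,
      indicator_of_mem (by rw [mem_ball_zero_iff]; linarith), Pi.one_apply, mul_one]
    have hq : A y ≤ q (rdir t) (2 - ‖t‖) := by
      refine le_min hle ((hN h hh y hy.2).trans ?_)
      rw [ENNReal.div_le_iff_le_mul (by left; simpa using hy.2) (by left; simp)]
      have e : β / ENNReal.ofReal (2 - ‖t‖) * ENNReal.ofReal (2 - ‖t‖) = β :=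
        ENNReal.div_mul_cancel (by simpa using ht) (by simp)
      have e2 : ENNReal.ofReal (2 - ‖t‖) ≤ 2 * ENNReal.ofReal (2 - ‖y‖) := by
        refine (ENNReal.ofReal_le_ofReal hts).trans (le_of_eq ?_)
        rw [ENNReal.ofReal_mul two_pos.le, ENNReal.ofReal_ofNat]
      have e3 : 2 * (N * b) ≤ 2 * (β / ENNReal.ofReal (2 - ‖t‖) * ENNReal.ofReal (2 - ‖y‖)) := by
        calc 2 * (N * b) = β / ENNReal.ofReal (2 - ‖t‖) * ENNReal.ofReal (2 - ‖t‖) := by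
              rw [e]; exact (mul_assoc _ _ _).symm
          _ ≤ β / ENNReal.ofReal (2 - ‖t‖) * (2 * ENNReal.ofReal (2 - ‖y‖)) := by gcongr
          _ = _ := by ring
      exact (ENNReal.mul_le_mul_iff_right (by simp) (by simp)).1 e3
    calc K y t * (h (rdir t) * A y ^ n)
        ≤ ENNReal.ofReal ((2 / (2 - ‖t‖)) ^ (n + 1) * M) *
          (h (rdir t) * q (rdir t) (2 - ‖t‖) ^ n) := by
          gcongr
          exact ENNReal.ofReal_le_ofReal hkle
      _ = _ := mul_comm _ _
  -- Integration in `y`: the ball of radius `2 - |t|` has volume comparable to the inverse of the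
  -- bound for the kernel.
  have integral_le_scale : ∫⁻ y in S, A y ^ (n + 1) ≤
      c * ∫⁻ t in ball (0 : Euc (n + 1)) 2, h (rdir t) * q (rdir t) (2 - ‖t‖) ^ n := by
    let P : Euc (n + 1) → ℝ≥0∞ := (ball (0 : Euc (n + 1)) 2).indicator fun t =>
      h (rdir t) * q (rdir t) (2 - ‖t‖) ^ n * ENNReal.ofReal ((2 / (2 - ‖t‖)) ^ (n + 1) * M)
    have hPm : Measurable P :=
      ((hhm.mul (((hhm.const_mul 2).min (measurable_const.div (by fun_prop))).pow_const n)).mul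
        (by fun_prop)).indicator measurableSet_ball
    let J : Euc (n + 1) → Euc (n + 1) → ℝ≥0∞ := fun t y =>
      (ball t (2 - ‖t‖)).indicator 1 y
    have hJm : Measurable fun p : Euc (n + 1) × Euc (n + 1) =>
        J p.2 p.1 := by
      have hset : MeasurableSet {p : Euc (n + 1) × Euc (n + 1) | dist p.1 p.2 < 2 - ‖p.2‖} :=
        measurableSet_lt (by fun_prop) (by fun_prop)
      exact ((measurable_one (α := ℝ≥0∞)).indicator hset :)
    calc ∫⁻ y in S, A y ^ (n + 1)
        ≤ ∫⁻ y in S, 2 * ∫⁻ t, P t * J t y := by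
          refine setLIntegral_mono' hSm fun y hy => (pow_le_restricted y hy).trans ?_
          exact mul_le_mul_right (lintegral_mono fun t => integrand_le y hy t) 2
      _ ≤ ∫⁻ y, 2 * ∫⁻ t, P t * J t y :=
          setLIntegral_le_lintegral _ _
      _ = 2 * ∫⁻ t, ∫⁻ y, P t * J t y := by
          rw [lintegral_const_mul' _ _ (by simp), lintegral_lintegral_swap]
          exact ((hPm.comp measurable_snd).mul hJm).aemeasurable
      _ = ∫⁻ t, 2 * (P t * volume (ball t (2 - ‖t‖))) := by
          rw [← lintegral_const_mul' _ _ (by simp)]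
          refine lintegral_congr fun t => ?_
          simp only [J]
          rw [lintegral_const_mul _ (measurable_one.indicator measurableSet_ball),
            lintegral_indicator_one measurableSet_ball]
      _ = ∫⁻ t, (ball (0 : Euc (n + 1)) 2).indicator (fun t =>
            c * (h (rdir t) * q (rdir t) (2 - ‖t‖) ^ n)) t := by
          refine lintegral_congr fun t => ?_
          by_cases ht : t ∈ ball (0 : Euc (n + 1)) 2
          · have hs : 0 < 2 - ‖t‖ := by
              rw [mem_ball_zero_iff] at ht; linarith
            simp only [P]
            rw [indicator_of_mem ht, indicator_of_mem ht, Measure.addHaar_ball _ _ hs.le,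
              finrank_euc]
            have e : ENNReal.ofReal ((2 / (2 - ‖t‖)) ^ (n + 1) * M) *
                (ENNReal.ofReal ((2 - ‖t‖) ^ (n + 1)) * V) =
                ENNReal.ofReal (2 ^ (n + 1) * M) * V := by
              rw [← mul_assoc, ← ENNReal.ofReal_mul (by positivity)]
              congr 2
              rw [div_pow]
              field_simp
            have hc : (c : ℝ≥0∞) = 2 * (ENNReal.ofReal (2 ^ (n + 1) * M) * V) := by
              rw [ENNReal.ofReal_mul (by positivity), ENNReal.ofReal_pow two_pos.le]
              simp only [c]
              push_cast
              rw [ENNReal.coe_toNNReal hV]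
              simp [ENNReal.ofReal]
            rw [hc, ← e]
            ring
          · simp only [P]
            rw [indicator_of_notMem ht, indicator_of_notMem ht]; simp
      _ = _ := by
          rw [lintegral_indicator measurableSet_ball, lintegral_const_mul' _ _ (by simp)]
  -- In polar coordinates the radial integral of `q ^ n` is `∫ min(2 h, β / s) ^ n ds`.
  have scale_integral_le : ∫⁻ t in ball (0 : Euc (n + 1)) 2, h (rdir t) * q (rdir t) (2 - ‖t‖) ^ n ≤
      2 ^ n * ∫⁻ x, h x * (2 * (2 * h x) ^ (n - 1) * β) ∂(surf n) := by
    have hqm : Measurable fun p : ℝ × Sph n => q p.2 p.1 :=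
      ((hh.comp measurable_snd).const_mul 2).min (measurable_const.div (by fun_prop))
    have hFm : Measurable ((ball (0 : Euc (n + 1)) 2).indicator fun t =>
        h (rdir t) * q (rdir t) (2 - ‖t‖) ^ n) :=
      (hhm.mul (((hhm.const_mul 2).min (measurable_const.div
        (by fun_prop))).pow_const n)).indicator measurableSet_ball
    let Q : ℝ → Sph n → ℝ≥0∞ := fun ρ x =>
      h x * (Ioi (0 : ℝ)).indicator (fun r => q x r ^ n) (2 - ρ)
    have hQm : Measurable (Function.uncurry Q) := by
      have h1 : Measurable fun p : ℝ × Sph n => q p.2 (2 - p.1) ^ n :=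
        (hqm.comp ((measurable_const.sub measurable_fst).prodMk measurable_snd)).pow_const n
      have hset : MeasurableSet {p : ℝ × Sph n | 2 - p.1 ∈ Ioi (0 : ℝ)} :=
        (measurable_const.sub measurable_fst) measurableSet_Ioi
      exact (hh.comp measurable_snd).mul (h1.indicator hset :)
    rw [← lintegral_indicator measurableSet_ball, lintegral_polar hFm]
    calc ∫⁻ ρ in Ioi (0 : ℝ), ENNReal.ofReal (ρ ^ n) * ∫⁻ x : Sph n,
          (ball (0 : Euc (n + 1)) 2).indicator (fun t => h (rdir t) * q (rdir t) (2 - ‖t‖) ^ n)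
            (ρ • (x : Euc (n + 1))) ∂(surf n)
        ≤ ∫⁻ ρ in Ioi (0 : ℝ), 2 ^ n * ∫⁻ x : Sph n, Q ρ x ∂(surf n) := by
          refine setLIntegral_mono' measurableSet_Ioi fun ρ hρ => ?_
          by_cases h2 : ρ < 2
          · refine mul_le_mul' ?_ (lintegral_mono fun x => ?_)
            · rw [ENNReal.ofReal_pow (le_of_lt hρ)]
              gcongr
              rw [← ENNReal.ofReal_ofNat]
              exact ENNReal.ofReal_le_ofReal h2.le
            · rw [indicator_of_mem (by rwa [mem_ball_zero_iff, norm_smul_sph hρ]), rdir_smul hρ,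
                norm_smul_sph hρ]
              simp only [Q]
              rw [indicator_of_mem (by rw [mem_Ioi]; linarith)]
          · have : ∀ x : Sph n, (ball (0 : Euc (n + 1)) 2).indicator
                (fun t => h (rdir t) * q (rdir t) (2 - ‖t‖) ^ n) (ρ • (x : Euc (n + 1))) = 0 :=
              fun x => indicator_of_notMem (by rwa [mem_ball_zero_iff, norm_smul_sph hρ]) _
            simp [this]
      _ ≤ ∫⁻ ρ, 2 ^ n * ∫⁻ x : Sph n, Q ρ x ∂(surf n) := setLIntegral_le_lintegral _ _
      _ = 2 ^ n * ∫⁻ x : Sph n, (∫⁻ ρ, Q ρ x) ∂(surf n) := by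
          rw [lintegral_const_mul' _ _ (by finiteness), lintegral_lintegral_swap hQm.aemeasurable]
      _ ≤ _ := by
          gcongr with x
          have hqx : Measurable fun r => q x r ^ n :=
            (measurable_const.min (measurable_const.div (by fun_prop))).pow_const n
          simp only [Q]
          have hqi : Measurable fun ρ => (Ioi (0 : ℝ)).indicator (fun r => q x r ^ n) (2 - ρ) :=
            (hqx.indicator measurableSet_Ioi).comp (measurable_const.sub measurable_id)
          rw [lintegral_const_mul _ hqi,
            lintegral_sub_left_eq_self (fun r => (Ioi (0 : ℝ)).indicator (fun r => q x r ^ n) r) 2,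
            lintegral_indicator measurableSet_Ioi]
          gcongr
          exact lintegral_min_div_pow_le hn _ _
  calc ∫⁻ y in S, A y ^ (n + 1)
      ≤ c * (2 ^ n * ∫⁻ x, h x * (2 * (2 * h x) ^ (n - 1) * β) ∂(surf n)) := by
        refine integral_le_scale.trans ?_
        gcongr
    _ = c * 2 ^ n * (2 * 2 ^ (n - 1) * (2 * N)) * b ^ (n + 1) := by
        have e1 : ∀ x, h x * (2 * (2 * h x) ^ (n - 1) * β) =
            (2 * 2 ^ (n - 1) * β) * h x ^ n := by
          intro x
          obtain ⟨k, rfl⟩ := Nat.exists_eq_succ_of_ne_zero hn0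
          simp only [Nat.succ_eq_add_one, Nat.add_sub_cancel]
          ring
        simp_rw [e1]
        rw [lintegral_const_mul _ (hh.pow_const n), ← hB, ← hbn]
        simp only [β]
        ring
    _ ≤ _ := by
        push_cast
        gcongr
        exact le_self_add

/-! ### Hausdorff measure of images -/

section Stretch

variable {E : Type*} [NormedAddCommGroup E] [InnerProductSpace ℝ E]

/-- The orthogonal projection onto the orthogonal complement of the unit vector `e`. -/
def perpProj (e : E) : E →L[ℝ] E := ContinuousLinearMap.id ℝ E - (innerSL ℝ e).smulRight e

/-- The linear map that multiplies the unit vector `e` by `α` and its orthogonal complement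
by `β`. -/
def stretch (e : E) (α β : ℝ) : E →L[ℝ] E := α • (innerSL ℝ e).smulRight e + β • perpProj e

theorem perpProj_apply (e v : E) : perpProj e v = v - ⟪e, v⟫ • e := by simp [perpProj]

theorem stretch_apply (e v : E) (α β : ℝ) :
    stretch e α β v = (α * ⟪e, v⟫) • e + β • perpProj e v := by
  simp [stretch, smul_smul]

theorem norm_perpProj_apply_le {e : E} (he : ‖e‖ = 1) (v : E) : ‖perpProj e v‖ ≤ ‖v‖ := by
  have h : ‖perpProj e v‖ ^ 2 ≤ ‖v‖ ^ 2 := by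
    rw [perpProj_apply, norm_sub_sq_real, norm_smul, inner_smul_right, real_inner_comm, he,
      Real.norm_eq_abs, mul_one, sq_abs]
    nlinarith [sq_nonneg ⟪e, v⟫]
  exact (sq_le_sq₀ (norm_nonneg _) (norm_nonneg _)).1 h

theorem stretch_stretch {e : E} (he : ‖e‖ = 1) (α β α' β' : ℝ) (v : E) :
    stretch e α β (stretch e α' β' v) = stretch e (α * α') (β * β') v := by
  have hee : ⟪e, e⟫ = (1 : ℝ) := by rw [real_inner_self_eq_norm_sq, he, one_pow]
  simp only [stretch_apply, perpProj_apply, inner_add_right, inner_smul_right, inner_sub_right, hee]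
  module

theorem stretch_one_one (e v : E) : stretch e 1 1 v = v := by
  simp [stretch_apply, perpProj_apply]

/-- `stretch e α β` as a continuous linear equivalence. -/
def stretchEquiv {e : E} (he : ‖e‖ = 1) {α β : ℝ} (hα : α ≠ 0) (hβ : β ≠ 0) : E ≃L[ℝ] E :=
  ContinuousLinearEquiv.equivOfInverse (stretch e α β) (stretch e α⁻¹ β⁻¹)
    (fun v => by rw [stretch_stretch he, inv_mul_cancel₀ hα, inv_mul_cancel₀ hβ, stretch_one_one])
    (fun v => by rw [stretch_stretch he, mul_inv_cancel₀ hα, mul_inv_cancel₀ hβ, stretch_one_one])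

theorem det_stretch [FiniteDimensional ℝ E] {e : E} (he : ‖e‖ = 1) (α : ℝ) {β : ℝ} (hβ : β ≠ 0) :
    LinearMap.det (stretch e α β : E →ₗ[ℝ] E) = β ^ Module.finrank ℝ E * (α / β) := by
  have h : (stretch e α β : E →ₗ[ℝ] E) =
      β • LinearMap.transvection ((α / β - 1) • (innerSL ℝ e : E →ₗ[ℝ] ℝ)) e := by
    ext v
    simp only [ContinuousLinearMap.coe_coe, stretch_apply, perpProj_apply, LinearMap.smul_apply,
      LinearMap.transvection.apply, innerSL_apply_apply, smul_eq_mul]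
    have : α = β * (α / β) := (mul_div_cancel₀ α hβ).symm
    nth_rw 1 [this]
    module
  rw [h, LinearMap.det_smul, LinearMap.transvection.det]
  simp [he]

end Stretch

/-- Near a point, a `C¹` map increases Hausdorff measure by at most the product of the size of its
derivative in a direction `e` and the `n`-th power of its size on the orthogonal complement: after
the linear change of variables that stretches space accordingly, the map is `2`-Lipschitz. -/
theorem hausdorffMeasure_image_le_of_near {F : Euc (n + 1) → Euc m} {U : Set (Euc (n + 1))}
    (hU : Convex ℝ U) (hF : ∀ z ∈ U, DifferentiableAt ℝ F z) {e : Euc (n + 1)} (he : ‖e‖ = 1)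
    {α β : ℝ} (hα : 0 < α) (hβ : 0 < β) (h1 : ∀ z ∈ U, ‖fderiv ℝ F z e‖ ≤ α)
    (h2 : ∀ z ∈ U, ‖fderiv ℝ F z ∘L perpProj e‖ ≤ β) {s : Set (Euc (n + 1))} (hs : s ⊆ U) :
    μH[(n + 1 : ℝ)] (F '' s) ≤
      2 ^ (n + 1) * (ENNReal.ofReal (α * β ^ n) * μH[(n + 1 : ℝ)] s) := by
  let M := stretchEquiv he hα.ne' hβ.ne'
  have hMs : ∀ v, M.symm v = stretch e α⁻¹ β⁻¹ v := fun _ => rfl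
  have hlip : LipschitzOnWith 2 (F ∘ M.symm) (M.symm ⁻¹' U) := by
    refine Convex.lipschitzOnWith_of_nnnorm_hasFDerivWithin_le (𝕜 := ℝ)
      (f' := fun v => fderiv ℝ F (M.symm v) ∘L (M.symm : Euc (n + 1) →L[ℝ] Euc (n + 1)))
      (fun v hv => ?_) (fun v hv => ?_)
      (hU.linear_preimage (M.symm : Euc (n + 1) →ₗ[ℝ] Euc (n + 1)))
    · exact ((hF _ hv).hasFDerivAt.comp v M.symm.hasFDerivAt).hasFDerivWithinAt
    · refine ContinuousLinearMap.opNorm_le_bound _ (by simp) fun w => ?_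
      have e1 : (fderiv ℝ F (M.symm v) ∘L (M.symm : Euc (n + 1) →L[ℝ] Euc (n + 1))) w =
          (α⁻¹ * ⟪e, w⟫) • fderiv ℝ F (M.symm v) e +
            β⁻¹ • (fderiv ℝ F (M.symm v) ∘L perpProj e) w := by
        simp [hMs, stretch_apply]
      rw [e1]
      have hin : |⟪e, w⟫| ≤ ‖w‖ := by simpa [he] using abs_real_inner_le_norm e w
      have b1 : ‖(α⁻¹ * ⟪e, w⟫) • fderiv ℝ F (M.symm v) e‖ ≤ ‖w‖ := by
        rw [norm_smul, norm_mul, Real.norm_eq_abs ⟪e, w⟫, norm_inv, Real.norm_of_nonneg hα.le]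
        calc α⁻¹ * |⟪e, w⟫| * ‖fderiv ℝ F (M.symm v) e‖ ≤ α⁻¹ * ‖w‖ * α := by
              gcongr
              exact h1 _ hv
          _ = ‖w‖ := by field_simp
      have b2 : ‖β⁻¹ • (fderiv ℝ F (M.symm v) ∘L perpProj e) w‖ ≤ ‖w‖ := by
        rw [norm_smul, norm_inv, Real.norm_of_nonneg hβ.le, inv_mul_le_iff₀ hβ]
        exact ContinuousLinearMap.le_of_opNorm_le _ (h2 _ hv) w
      calc _ ≤ ‖w‖ + ‖w‖ := (norm_add_le _ _).trans (add_le_add b1 b2)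
        _ = (2 : ℝ≥0) * ‖w‖ := by simp; ring
  have hsub : M '' s ⊆ M.symm ⁻¹' U := by
    rintro _ ⟨z, hz, rfl⟩
    simpa using hs hz
  have himg : F '' s = (F ∘ M.symm) '' (M '' s) := by
    rw [image_image]; simp
  have hd : (n + 1 : ℝ) = Module.finrank ℝ (Euc (n + 1)) := by rw [finrank_euc]; push_cast; rfl
  have hMvol : μH[(n + 1 : ℝ)] (M '' s) = ENNReal.ofReal (α * β ^ n) * μH[(n + 1 : ℝ)] s := by
    rw [hd, Measure.addHaar_image_continuousLinearEquiv]
    congr 2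
    have : LinearMap.det ((M : Euc (n + 1) →L[ℝ] Euc (n + 1)) : Euc (n + 1) →ₗ[ℝ] Euc (n + 1)) =
        α * β ^ n := by
      refine (det_stretch he α hβ.ne').trans ?_
      rw [finrank_euc, pow_succ]
      field_simp
    rw [← abs_of_nonneg (show 0 ≤ α * β ^ n by positivity), ← this]
    rfl
  rw [himg, ← hMvol]
  refine ((hlip.mono hsub).hausdorffMeasure_image_le (by positivity)).trans (le_of_eq ?_)
  congr 1
  rw [show (n + 1 : ℝ) = ((n + 1 : ℕ) : ℝ) by push_cast; rfl, ENNReal.rpow_natCast]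
  rfl

theorem exists_hausdorffMeasure_eq_smul (n : ℕ) : ∃ κ : ℝ≥0,
    (μH[(n + 1 : ℝ)] : Measure (Euc (n + 1))) = κ • volume := by
  have hd : (n + 1 : ℝ) = Module.finrank ℝ (Euc (n + 1)) := by rw [finrank_euc]; push_cast; rfl
  rw [hd]
  exact ⟨_, Measure.isAddLeftInvariant_eq_smul _ _⟩

/-- A local bound of the measure of images by an integral is global, by a countable cover made
disjoint. -/
theorem hausdorffMeasure_image_le_lintegral_of_local {F : Euc (n + 1) → Euc m}
    {S : Set (Euc (n + 1))} (hS : MeasurableSet S) {w : Euc (n + 1) → ℝ≥0∞}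
    (h : ∀ y ∈ S, ∃ U : Set (Euc (n + 1)), IsOpen U ∧ y ∈ U ∧ ∀ s ⊆ U ∩ S, MeasurableSet s →
      μH[(n + 1 : ℝ)] (F '' s) ≤ ∫⁻ x in s, w x) :
    μH[(n + 1 : ℝ)] (F '' S) ≤ ∫⁻ x in S, w x := by
  rcases S.eq_empty_or_nonempty with rfl | hne
  · simp
  choose! U hUo hyU hU using h
  obtain ⟨t, htS, htc, hcov⟩ := TopologicalSpace.countable_cover_nhdsWithin (s := S) (f := U)
    fun y hy => mem_nhdsWithin_of_mem_nhds ((hUo y hy).mem_nhds (hyU y hy))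
  have htne : t.Nonempty := by
    obtain ⟨y, hy⟩ := hne
    obtain ⟨i, hi, -⟩ := mem_iUnion₂.1 (hcov hy)
    exact ⟨i, hi⟩
  obtain ⟨p, rfl⟩ := htc.exists_eq_range htne
  have hpS : ∀ i, p i ∈ S := fun i => htS ⟨i, rfl⟩
  let D : ℕ → Set (Euc (n + 1)) := disjointed fun i => U (p i) ∩ S
  have hDm : ∀ i, MeasurableSet (D i) := fun i =>
    MeasurableSet.disjointed (fun j => (hUo _ (hpS j)).measurableSet.inter hS) i
  have hDU : ⋃ i, D i = S := by
    rw [iUnion_disjointed, ← iUnion_inter, inter_eq_right]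
    intro y hy
    obtain ⟨i, ⟨j, rfl⟩, hi⟩ := mem_iUnion₂.1 (hcov hy)
    exact mem_iUnion.2 ⟨j, hi⟩
  calc μH[(n + 1 : ℝ)] (F '' S) = μH[(n + 1 : ℝ)] (⋃ i, F '' D i) := by
        rw [← image_iUnion, hDU]
    _ ≤ ∑' i, μH[(n + 1 : ℝ)] (F '' D i) := measure_iUnion_le _
    _ ≤ ∑' i, ∫⁻ x in D i, w x := ENNReal.tsum_le_tsum fun i =>
        hU (p i) (hpS i) _ (disjointed_le _ i) (hDm i)
    _ = ∫⁻ x in S, w x := by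
        rw [← lintegral_iUnion hDm (disjoint_disjointed _), hDU]

/-- An anisotropic form of the area inequality: the derivative enters through its size in the
direction `e y` and the `n`-th power of its size on the orthogonal complement of `e y`. -/
theorem exists_hausdorffMeasure_image_le (n m : ℕ) : ∃ κ : ℝ≥0, ∀ (F : Euc (n + 1) → Euc m)
    (Ω S : Set (Euc (n + 1))) (e : Euc (n + 1) → Euc (n + 1)), IsOpen Ω → ContDiffOn ℝ 1 F Ω →
    ContinuousOn e Ω → (∀ y ∈ Ω, ‖e y‖ = 1) → S ⊆ Ω → MeasurableSet S → volume S ≠ ⊤ →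
    μH[(n + 1 : ℝ)] (F '' S) ≤
      κ * ∫⁻ y in S, ‖fderiv ℝ F y (e y)‖ₑ * ‖fderiv ℝ F y ∘L perpProj (e y)‖ₑ ^ n := by
  obtain ⟨κ, hκ⟩ := exists_hausdorffMeasure_eq_smul n
  refine ⟨2 ^ (n + 1) * κ, fun F Ω S e hΩ hF he he1 hSΩ hS hvol => ?_⟩
  let a : Euc (n + 1) → ℝ := fun y => ‖fderiv ℝ F y (e y)‖
  let b : Euc (n + 1) → ℝ := fun y => ‖fderiv ℝ F y ∘L perpProj (e y)‖
  let w : Euc (n + 1) → ℝ := fun y => a y * b y ^ n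
  have hd : ∀ y ∈ Ω, ContinuousAt (fderiv ℝ F) y := fun y hy =>
    (hF.continuousOn_fderiv_of_isOpen hΩ le_rfl).continuousAt (hΩ.mem_nhds hy)
  have hec : ∀ y ∈ Ω, ContinuousAt e y := fun y hy => he.continuousAt (hΩ.mem_nhds hy)
  have hpc : Continuous (perpProj : Euc (n + 1) → _) := by
    unfold perpProj
    have : Continuous fun p : Euc (n + 1) =>
        ContinuousLinearMap.smulRightL ℝ (Euc (n + 1)) (Euc (n + 1)) (innerSL ℝ p) p :=
      ((ContinuousLinearMap.smulRightL ℝ _ _).continuous.comp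
        (innerSL ℝ).continuous).clm_apply continuous_id
    exact continuous_const.sub this
  have hac : ∀ y ∈ Ω, ContinuousAt a y := fun y hy => ((hd y hy).clm_apply (hec y hy)).norm
  have hbc : ∀ y ∈ Ω, ContinuousAt b y := fun y hy =>
    ((hd y hy).clm_comp (hpc.continuousAt.comp (hec y hy))).norm
  have hwc : ∀ y ∈ Ω, ContinuousAt w y := fun y hy => (hac y hy).mul ((hbc y hy).pow n)
  have hw0 : ∀ y, 0 ≤ w y := fun y => by positivity
  have hw : ∀ y, ‖fderiv ℝ F y (e y)‖ₑ * ‖fderiv ℝ F y ∘L perpProj (e y)‖ₑ ^ n =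
      ENNReal.ofReal (w y) := fun y => by
    rw [ENNReal.ofReal_mul (norm_nonneg _), ENNReal.ofReal_pow (norm_nonneg _), ofReal_norm,
      ofReal_norm]
  simp_rw [hw]
  have key : ∀ δ : ℝ, 0 < δ → μH[(n + 1 : ℝ)] (F '' S) ≤
      ∫⁻ y in S, 2 ^ (n + 1) * κ * (ENNReal.ofReal (w y) + ENNReal.ofReal (2 * δ)) := by
    intro δ hδ
    refine hausdorffMeasure_image_le_lintegral_of_local hS fun y hyS => ?_
    have hy := hSΩ hyS
    have hεe : ∃ ε : ℝ, 0 < ε ∧ (a y + ε) * (b y + ε) ^ n < w y + δ := by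
      have hc : Filter.Tendsto (fun ε : ℝ => (a y + ε) * (b y + ε) ^ n) (nhdsWithin 0 (Ioi 0))
          (nhds ((a y + 0) * (b y + 0) ^ n)) :=
        ((by fun_prop : Continuous fun ε : ℝ => (a y + ε) * (b y + ε) ^ n).tendsto 0).mono_left
          nhdsWithin_le_nhds
      have h1 : (a y + 0) * (b y + 0) ^ n < w y + δ := by simpa [w] using hδ
      obtain ⟨ε, h2, h3⟩ := ((hc.eventually_lt_const h1).and self_mem_nhdsWithin).exists
      exact ⟨ε, h3, h2⟩
    obtain ⟨ε, hε, hεw⟩ := hεe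
    have hA : ∀ᶠ z in nhds y, ‖fderiv ℝ F z (e y)‖ < a y + ε :=
      ((hd y hy).clm_apply continuousAt_const).norm.eventually_lt_const (lt_add_of_pos_right _ hε)
    have hB : ∀ᶠ z in nhds y, ‖fderiv ℝ F z ∘L perpProj (e y)‖ < b y + ε :=
      ((hd y hy).clm_comp continuousAt_const).norm.eventually_lt_const (lt_add_of_pos_right _ hε)
    have hW : ∀ᶠ z in nhds y, w y - δ < w z :=
      (hwc y hy).eventually_const_lt (sub_lt_self _ hδ)
    obtain ⟨r, hr, hball⟩ := Metric.eventually_nhds_iff_ball.1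
      (((hA.and hB).and hW).and (hΩ.eventually_mem hy))
    refine ⟨ball y r, isOpen_ball, mem_ball_self hr, fun s hs hsm => ?_⟩
    have hsb : s ⊆ ball y r := hs.trans inter_subset_left
    have ha0 : 0 ≤ a y := norm_nonneg _
    have hb0 : 0 ≤ b y := norm_nonneg _
    have h3 := hausdorffMeasure_image_le_of_near (F := F) (convex_ball y r)
      (fun z hz => (hF.differentiableOn one_ne_zero).differentiableAt
        (hΩ.mem_nhds (hball z hz).2)) (he1 y hy) (α := a y + ε) (β := b y + ε)
      (by positivity) (by positivity)
      (fun z hz => (hball z hz).1.1.1.le) (fun z hz => (hball z hz).1.1.2.le) hsb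
    refine h3.trans ?_
    calc 2 ^ (n + 1) * (ENNReal.ofReal ((a y + ε) * (b y + ε) ^ n) * μH[(n + 1 : ℝ)] s)
        ≤ 2 ^ (n + 1) * (ENNReal.ofReal (w y + δ) * (κ * volume s)) := by
          rw [hκ]
          gcongr
          exact le_rfl
      _ = ∫⁻ _ in s, 2 ^ (n + 1) * κ * ENNReal.ofReal (w y + δ) := by
          rw [setLIntegral_const]; ring
      _ ≤ _ := by
          refine setLIntegral_mono' hsm fun x hx => ?_
          rw [← ENNReal.ofReal_add (hw0 x) (by positivity)]
          exact mul_le_mul_right (ENNReal.ofReal_le_ofReal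
            (by linarith [(hball x (hsb hx)).1.2])) _
  have hlim : Filter.Tendsto (fun δ : ℝ => 2 ^ (n + 1) * κ * (∫⁻ y in S, ENNReal.ofReal (w y)) +
      2 ^ (n + 1) * κ * (ENNReal.ofReal (2 * δ) * volume S)) (nhdsWithin 0 (Ioi 0))
      (nhds (2 ^ (n + 1) * κ * (∫⁻ y in S, ENNReal.ofReal (w y)) +
      2 ^ (n + 1) * κ * (ENNReal.ofReal (2 * 0) * volume S))) := by
    refine tendsto_const_nhds.add ?_
    refine ENNReal.Tendsto.const_mul (ENNReal.Tendsto.mul_const ?_ (Or.inr hvol))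
      (Or.inr (by finiteness))
    exact (ENNReal.continuous_ofReal.comp
      (by fun_prop : Continuous fun δ : ℝ => 2 * δ)).continuousAt.tendsto.mono_left
      nhdsWithin_le_nhds
  have hfin := ge_of_tendsto hlim (b := μH[(n + 1 : ℝ)] (F '' S)) (by
    filter_upwards [self_mem_nhdsWithin] with δ hδ
    refine (key δ hδ).trans (le_of_eq ?_)
    rw [lintegral_const_mul' _ _ (by finiteness), lintegral_add_right _ measurable_const,
      setLIntegral_const, mul_add])
  simpa using hfin

/-! ### Norms -/

theorem norm_le_hsNorm {k : ℕ} (A : Euc k →L[ℝ] Euc m) : ‖A‖ ≤ hsNorm A := by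
  refine A.opNorm_le_bound (Real.sqrt_nonneg _) fun v => ?_
  have hv : v = ∑ i, v i • EuclideanSpace.single i (1 : ℝ) := by
    simpa using ((EuclideanSpace.basisFun (Fin k) ℝ).sum_repr v).symm
  calc ‖A v‖ = ‖∑ i, v i • A (EuclideanSpace.single i 1)‖ := by
        conv_lhs => rw [hv]
        simp only [map_sum, map_smul]
    _ ≤ ∑ i, ‖A (EuclideanSpace.single i 1)‖ * ‖v i‖ := by
        refine (norm_sum_le _ _).trans (le_of_eq ?_)
        simp only [norm_smul, mul_comm]
    _ ≤ hsNorm A * ‖v‖ := by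
        rw [EuclideanSpace.norm_eq]
        exact Real.sum_mul_le_sqrt_mul_sqrt _ _ _

theorem enorm_le_ofReal_hsNorm {k : ℕ} (A : Euc k →L[ℝ] Euc m) :
    ‖A‖ₑ ≤ ENNReal.ofReal (hsNorm A) := by
  rw [← ofReal_norm]
  exact ENNReal.ofReal_le_ofReal (norm_le_hsNorm A)

theorem lintegral_enorm_add_le_w1Norm (hn : 2 ≤ n) (u : Sph n → Euc m) :
    (∫⁻ x, (‖u x‖ₑ + ‖weakDeriv u x‖ₑ) ^ n ∂(surf n)) ^ (1 / (n : ℝ)) ≤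
      2 * w1Norm (n : ℝ≥0) u := by
  have hn0 : (0 : ℝ) < n := by positivity
  have h1 : ∀ x, (‖u x‖ₑ + ‖weakDeriv u x‖ₑ) ^ n ≤
      2 ^ n * (ENNReal.ofReal (‖u x‖ ^ ((n : ℝ≥0) : ℝ)) +
        ENNReal.ofReal (hsNorm (weakDeriv u x) ^ ((n : ℝ≥0) : ℝ))) := by
    intro x
    have h2 := ENNReal.ofReal_le_ofReal (norm_le_hsNorm (weakDeriv u x))
    rw [ofReal_norm] at h2
    rw [NNReal.coe_natCast, Real.rpow_natCast, Real.rpow_natCast,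
      ENNReal.ofReal_pow (norm_nonneg _),
      ENNReal.ofReal_pow (show 0 ≤ hsNorm (weakDeriv u x) from Real.sqrt_nonneg _), ofReal_norm]
    calc (‖u x‖ₑ + ‖weakDeriv u x‖ₑ) ^ n
        ≤ (2 * max ‖u x‖ₑ (ENNReal.ofReal (hsNorm (weakDeriv u x)))) ^ n := by
          gcongr
          rw [two_mul]
          exact add_le_add (le_max_left _ _) (h2.trans (le_max_right _ _))
      _ = 2 ^ n * max ‖u x‖ₑ (ENNReal.ofReal (hsNorm (weakDeriv u x))) ^ n := mul_pow _ _ _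
      _ ≤ _ := by
          gcongr
          rcases max_choice ‖u x‖ₑ (ENNReal.ofReal (hsNorm (weakDeriv u x))) with h | h <;> rw [h]
          · exact le_self_add
          · exact le_add_self
  calc (∫⁻ x, (‖u x‖ₑ + ‖weakDeriv u x‖ₑ) ^ n ∂(surf n)) ^ (1 / (n : ℝ))
      ≤ (∫⁻ x, 2 ^ n * (ENNReal.ofReal (‖u x‖ ^ ((n : ℝ≥0) : ℝ)) +
        ENNReal.ofReal (hsNorm (weakDeriv u x) ^ ((n : ℝ≥0) : ℝ))) ∂(surf n)) ^ (1 / (n : ℝ)) := by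
        gcongr with x
        exact h1 x
    _ = 2 * w1Norm (n : ℝ≥0) u := by
        rw [lintegral_const_mul' _ _ (by finiteness),
          ENNReal.mul_rpow_of_nonneg _ _ (by positivity),
          ← ENNReal.rpow_natCast, ← ENNReal.rpow_mul, mul_one_div_cancel hn0.ne', ENNReal.rpow_one]
        rfl

theorem hasWeakDeriv_weakDeriv {u : Sph n → Euc m} (h : ∃ G, HasWeakDeriv u G) :
    HasWeakDeriv u (weakDeriv u) := by
  rw [weakDeriv, dif_pos h]
  exact h.choose_spec

/-! ### The homotopy -/

/-- The map on the shell `1 ≤ |y| ≤ 2` that joins `g` on the inner sphere to `g + u` on the outer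
sphere. -/
def shellMap (g u : Sph n → Euc m) (y : Euc (n + 1)) : Euc m :=
  radialExt g y + (‖y‖ - 1) • mollExt u y

theorem shellMap_sph (g u : Sph n → Euc m) (x : Sph n) : shellMap g u (x : Euc (n + 1)) = g x := by
  rw [shellMap, norm_sph, sub_self, zero_smul, add_zero]
  simpa using radialExt_smul g one_pos x

theorem shellMap_two_smul (g u : Sph n → Euc m) (x : Sph n) :
    shellMap g u ((2 : ℝ) • (x : Euc (n + 1))) = g x + u x := by
  have h2 := norm_smul_sph two_pos x
  rw [shellMap, radialExt_smul g two_pos, mollExt_of_norm_eq_two h2, h2, rdir_smul two_pos]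
  norm_num

theorem continuousOn_shellMap {g u : Sph n → Euc m} (hg : Continuous g) (hu : Continuous u) :
    ContinuousOn (shellMap g u) {y | 1 ≤ ‖y‖ ∧ ‖y‖ ≤ 2} := by
  refine ((continuousOn_radialExt hg).mono fun y hy h0 => ?_).add
    ((continuous_norm.sub continuous_const).continuousOn.smul (continuousOn_mollExt hu))
  have h0' : y = 0 := h0
  have := hy.1
  rw [h0', norm_zero] at this
  linarith

theorem contDiffAt_shellMap {g u : Sph n → Euc m} (hg : ContMDiff (𝓡 n) 𝓘(ℝ, Euc m) ∞ g)
    (hu : Integrable u (surf n)) {y : Euc (n + 1)} (hy : y ≠ 0) (hy2 : ‖y‖ < 2) :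
    ContDiffAt ℝ ∞ (shellMap g u) y :=
  (contDiffAt_radialExt hg hy).add
    (((contDiffAt_norm ℝ hy).sub contDiffAt_const).smul (contDiffAt_mollExt hu hy hy2))

theorem fderiv_shellMap_apply {g u : Sph n → Euc m} (hg : ContMDiff (𝓡 n) 𝓘(ℝ, Euc m) ∞ g)
    (hu : Integrable u (surf n)) {y : Euc (n + 1)} (hy : y ≠ 0) (hy2 : ‖y‖ < 2)
    (v : Euc (n + 1)) : fderiv ℝ (shellMap g u) y v = ‖y‖⁻¹ • sphDeriv g (rdir y) v +
      ((‖y‖ - 1) • fderiv ℝ (mollExt u) y v + ⟪(rdir y : Euc (n + 1)), v⟫ • mollExt u y) := by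
  have h1 := hasFDerivAt_radialExt hg hy
  have h2 := ((contDiffAt_mollExt hu hy hy2).differentiableAt (by simp)).hasFDerivAt
  have h3 := h1.add (((hasFDerivAt_norm_euc hy).sub_const 1).smul h2)
  have h4 : fderiv ℝ (radialExt g) y = ‖y‖⁻¹ • sphDeriv g (rdir y) := by
    conv_lhs => rw [← norm_smul_rdir hy]
    exact fderiv_radialExt_smul hg (norm_pos_iff.2 hy) _
  refine (congrArg (· v) h3.fderiv).trans ?_
  simp [h4]

/-- The derivative of the shell map: only the small function `u` contributes in the radial
direction. -/
theorem enorm_fderiv_shellMap_le {g u : Sph n → Euc m} (hg : ContMDiff (𝓡 n) 𝓘(ℝ, Euc m) ∞ g)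
    {G : Sph n → Euc (n + 1) →L[ℝ] Euc m} (hu : HasWeakDeriv u G) {y : Euc (n + 1)}
    (hy1 : 1 ≤ ‖y‖) (hy2 : ‖y‖ < 2) :
    ‖fderiv ℝ (shellMap g u) y (rdir y)‖ₑ ≤ 5 * localAvg (fun x => ‖u x‖ₑ + ‖G x‖ₑ) y ∧
    ‖fderiv ℝ (shellMap g u) y ∘L perpProj (rdir y : Euc (n + 1))‖ₑ ≤
      ‖sphDeriv g (rdir y)‖ₑ + 5 * localAvg (fun x => ‖u x‖ₑ + ‖G x‖ₑ) y := by
  have hy0 : y ≠ 0 := norm_pos_iff.1 (by linarith)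
  set A := localAvg (fun x => ‖u x‖ₑ + ‖G x‖ₑ) y with hA
  have hmono : ∀ {h₁ h₂ : Sph n → ℝ≥0∞}, (∀ x, h₁ x ≤ h₂ x) → localAvg h₁ y ≤ localAvg h₂ y :=
    fun h => lintegral_mono fun t => by
      dsimp only
      gcongr
      exact h _
  have hW : ‖mollExt u y‖ₑ ≤ A :=
    (enorm_mollExt_le u hy2).trans (hmono fun x => le_self_add)
  have hD : ‖fderiv ℝ (mollExt u) y‖ₑ ≤ 4 * A :=
    (hu.enorm_fderiv_mollExt_le hy1 hy2).trans (by
      gcongr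
      exact hmono fun x => le_add_self)
  -- the contribution of `u` to the derivative
  let T : Euc (n + 1) → Euc m := fun v =>
    (‖y‖ - 1) • fderiv ℝ (mollExt u) y v + ⟪(rdir y : Euc (n + 1)), v⟫ • mollExt u y
  have hT : ∀ v, ‖T v‖ₑ ≤ 5 * A * ‖v‖ₑ := by
    intro v
    have h1 : ‖(‖y‖ - 1)‖ₑ ≤ 1 := by
      rw [Real.enorm_of_nonneg (by linarith)]
      exact ENNReal.ofReal_le_one.2 (by linarith)
    have h2 : ‖⟪(rdir y : Euc (n + 1)), v⟫‖ₑ ≤ ‖v‖ₑ := by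
      rw [← ofReal_norm, ← ofReal_norm]
      exact ENNReal.ofReal_le_ofReal (by
        simpa using abs_real_inner_le_norm (rdir y : Euc (n + 1)) v)
    calc ‖T v‖ₑ ≤ ‖(‖y‖ - 1)‖ₑ * ‖fderiv ℝ (mollExt u) y v‖ₑ +
          ‖⟪(rdir y : Euc (n + 1)), v⟫‖ₑ * ‖mollExt u y‖ₑ := by
          rw [← enorm_smul, ← enorm_smul]; exact enorm_add_le _ _
      _ ≤ 1 * (4 * A * ‖v‖ₑ) + ‖v‖ₑ * A := by
          gcongr
          exact ((fderiv ℝ (mollExt u) y).le_opENorm v).trans (by gcongr)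
      _ = 5 * A * ‖v‖ₑ := by ring
  have hF : ∀ v, fderiv ℝ (shellMap g u) y v = ‖y‖⁻¹ • sphDeriv g (rdir y) v + T v :=
    fderiv_shellMap_apply hg hu.integrable hy0 hy2
  constructor
  · rw [hF, sphDeriv_normal hg, smul_zero, zero_add]
    refine (hT _).trans (le_of_eq ?_)
    rw [← ofReal_norm (rdir y : Euc (n + 1)), norm_sph, ENNReal.ofReal_one, mul_one]
  · have key : ∀ v, ‖(fderiv ℝ (shellMap g u) y ∘L perpProj (rdir y : Euc (n + 1))) v‖ₑ ≤
        (‖sphDeriv g (rdir y)‖ₑ + 5 * A) * ‖v‖ₑ := by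
      intro v
      rw [ContinuousLinearMap.comp_apply, hF]
      have hp : ‖perpProj (rdir y : Euc (n + 1)) v‖ₑ ≤ ‖v‖ₑ := by
        rw [← ofReal_norm, ← ofReal_norm]
        exact ENNReal.ofReal_le_ofReal (norm_perpProj_apply_le (norm_sph _) v)
      have hi : ‖(‖y‖⁻¹ : ℝ)‖ₑ ≤ 1 := by
        rw [Real.enorm_of_nonneg (by positivity)]
        exact ENNReal.ofReal_le_one.2 (inv_le_one_of_one_le₀ hy1)
      refine (enorm_add_le _ _).trans ?_
      rw [add_mul, enorm_smul]
      refine add_le_add ?_ ((hT _).trans (by gcongr))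
      calc _ ≤ 1 * (‖sphDeriv g (rdir y)‖ₑ * ‖perpProj (rdir y : Euc (n + 1)) v‖ₑ) := by
            gcongr
            exact (sphDeriv g (rdir y)).le_opENorm _
        _ ≤ ‖sphDeriv g (rdir y)‖ₑ * ‖v‖ₑ := by rw [one_mul]; gcongr
    by_cases htop : ‖sphDeriv g (rdir y)‖ₑ + 5 * A = ⊤
    · rw [htop]; exact le_top
    rw [← ENNReal.coe_toNNReal htop, enorm_le_coe]
    refine ContinuousLinearMap.opNNNorm_le_bound _ _ fun v => ?_
    have := key v
    rw [← ENNReal.coe_toNNReal htop] at this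
    simpa only [enorm_eq_nnnorm, ← ENNReal.coe_mul, ENNReal.coe_le_coe] using this

/-- Hölder's and Minkowski's inequalities, for the product that bounds the Jacobian. -/
theorem lintegral_mul_add_pow_le {X : Type*} [MeasurableSpace X] {μ : Measure X}
    {a c : X → ℝ≥0∞} (ha : Measurable a) (hc : Measurable c) (n : ℕ) (hn : n ≠ 0) :
    ∫⁻ x, a x * (c x + a x) ^ n ∂μ ≤
      (∫⁻ x, a x ^ (n + 1) ∂μ) ^ (1 / (n + 1 : ℝ)) *
        ((∫⁻ x, c x ^ (n + 1) ∂μ) ^ (1 / (n + 1 : ℝ)) +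
          (∫⁻ x, a x ^ (n + 1) ∂μ) ^ (1 / (n + 1 : ℝ))) ^ n := by
  have hn0 : (0 : ℝ) < n := by positivity
  have hp : (1 : ℝ) < n + 1 := by linarith
  have hpq := Real.HolderConjugate.conjExponent hp
  have hN : ∀ z : ℝ≥0∞, z ^ (n + 1) = z ^ (n + 1 : ℝ) := fun z => by
    rw [← ENNReal.rpow_natCast]; push_cast; rfl
  have hN' : ∀ z : ℝ≥0∞, z ^ n = z ^ ((n + 1 : ℝ) - 1) := fun z => by
    rw [← ENNReal.rpow_natCast]; congr 1; ring
  have h1 := ENNReal.lintegral_mul_rpow_le_lintegral_rpow_mul_lintegral_rpow (μ := μ) hpq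
    ha.aemeasurable (hc.add ha).aemeasurable
  have h2 := ENNReal.lintegral_Lp_add_le (μ := μ) hc.aemeasurable ha.aemeasurable hp.le
  have e : ∀ z : ℝ≥0∞, z ^ (1 / (n + 1 : ℝ).conjExponent) = (z ^ (1 / (n + 1 : ℝ))) ^ n := by
    intro z
    rw [← ENNReal.rpow_natCast, ← ENNReal.rpow_mul, Real.conjExponent]
    congr 1
    field_simp
    ring
  simp only [hN, hN' (_ + _)]
  refine h1.trans ?_
  rw [e]
  simp only [Pi.add_apply] at h2 ⊢
  have e3 : ∀ z : ℝ≥0∞, z ^ n = z ^ ((n + 1 : ℝ) - 1) := hN'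
  rw [← e3]
  gcongr

theorem lintegral_shell_comp_rdir_le {c : Sph n → ℝ≥0∞} (hc : Measurable c) :
    (∫⁻ y in {y : Euc (n + 1) | 1 ≤ ‖y‖ ∧ ‖y‖ < 2}, c (rdir y) ^ (n + 1)) ^ (1 / (n + 1 : ℝ)) ≤
      2 * (∫⁻ x, c x ^ (n + 1) ∂(surf n)) ^ (1 / (n + 1 : ℝ)) := by
  have hS : MeasurableSet {y : Euc (n + 1) | 1 ≤ ‖y‖ ∧ ‖y‖ < 2} :=
    (measurableSet_le measurable_const measurable_norm).inter
      (measurableSet_lt measurable_norm measurable_const)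
  have h1 : ∫⁻ y in {y : Euc (n + 1) | 1 ≤ ‖y‖ ∧ ‖y‖ < 2}, c (rdir y) ^ (n + 1) ≤
      2 ^ (n + 1) * ∫⁻ x, c x ^ (n + 1) ∂(surf n) := by
    rw [← lintegral_indicator hS]
    have e : ∀ y : Euc (n + 1), {y : Euc (n + 1) | 1 ≤ ‖y‖ ∧ ‖y‖ < 2}.indicator
        (fun y => c (rdir y) ^ (n + 1)) y =
          (Ico (1 : ℝ) 2).indicator 1 ‖y‖ * c (rdir y) ^ (n + 1) := by
      intro y
      by_cases hy : 1 ≤ ‖y‖ ∧ ‖y‖ < 2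
      · rw [indicator_of_mem (by exact hy), indicator_of_mem (by exact hy), Pi.one_apply, one_mul]
      · rw [indicator_of_notMem (by exact hy), indicator_of_notMem (by exact hy), zero_mul]
    simp_rw [e]
    rw [lintegral_radial_mul (b := fun x => c x ^ (n + 1))
      (measurable_one.indicator measurableSet_Ico)
      (hc.pow_const _).aemeasurable]
    gcongr
    calc ∫⁻ ρ in Ioi (0 : ℝ), ENNReal.ofReal (ρ ^ n) * (Ico (1 : ℝ) 2).indicator 1 ρ
        ≤ ∫⁻ ρ in Ioi (0 : ℝ), (Ico (1 : ℝ) 2).indicator (fun _ => 2 ^ (n + 1)) ρ := by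
          refine setLIntegral_mono' measurableSet_Ioi fun ρ hρ => ?_
          by_cases h : ρ ∈ Ico (1 : ℝ) 2
          · rw [indicator_of_mem h, indicator_of_mem h, Pi.one_apply, mul_one,
              ENNReal.ofReal_pow (le_of_lt hρ)]
            calc ENNReal.ofReal ρ ^ n ≤ 2 ^ n := by
                  gcongr
                  rw [← ENNReal.ofReal_ofNat]
                  exact ENNReal.ofReal_le_ofReal h.2.le
              _ ≤ 2 ^ (n + 1) := pow_le_pow_right₀ (by norm_num) (Nat.le_succ n)
          · rw [indicator_of_notMem h, mul_zero]; exact zero_le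
      _ ≤ ∫⁻ ρ, (Ico (1 : ℝ) 2).indicator (fun _ => 2 ^ (n + 1)) ρ := setLIntegral_le_lintegral _ _
      _ = 2 ^ (n + 1) := by
          rw [lintegral_indicator_const measurableSet_Ico, Real.volume_Ico]
          norm_num
  calc _ ≤ (2 ^ (n + 1) * ∫⁻ x, c x ^ (n + 1) ∂(surf n)) ^ (1 / (n + 1 : ℝ)) := by gcongr
    _ = _ := by
        rw [ENNReal.mul_rpow_of_nonneg _ _ (by positivity), ← ENNReal.rpow_natCast,
          ← ENNReal.rpow_mul]
        push_cast
        rw [mul_one_div_cancel (by positivity), ENNReal.rpow_one]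

end SphereSobolev

end

open SphereSobolev in
theorem mainTheorem5 (n m : ℕ) (hn : 2 ≤ n) (hm : n + 1 ≤ m) :
    ∃ C : ℝ≥0, ∀ f g : Sph n → Euc m,
      MemW1 (n : ℝ≥0) f → Continuous f → ContMDiff (𝓡 n) 𝓘(ℝ, Euc m) ∞ g →
      ∃ H : Sph n × ℝ → Euc m,
        ContinuousOn H (univ ×ˢ Icc (0 : ℝ) 1) ∧
        ContMDiffOn ((𝓡 n).prod 𝓘(ℝ, ℝ)) 𝓘(ℝ, Euc m) ∞ H (univ ×ˢ Ico (0 : ℝ) 1) ∧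
        (∀ x, H (x, 0) = g x) ∧
        (∀ x, H (x, 1) = f x) ∧
        μH[(n + 1 : ℝ)] (H '' (univ ×ˢ Ico (0 : ℝ) 1)) ≤
          C * w1Norm (n : ℝ≥0) (f - g) *
            (w1Norm (n : ℝ≥0) (f - g) +
              eLpNorm (fun x => hsNorm (sphDeriv g x)) (n + 1 : ℝ≥0∞) (surf n)) ^ n := by
  obtain ⟨κ, hκ⟩ := exists_hausdorffMeasure_image_le n m
  obtain ⟨C₁, hC₁⟩ := exists_lintegral_localAvg_pow_le hn
  have hn0 : n ≠ 0 := by omega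
  let c₁ : ℝ≥0 := C₁ ^ (1 / (n + 1 : ℝ))
  refine ⟨κ * (10 * c₁) * (2 + 10 * c₁) ^ n, fun f g hf hfc hg => ?_⟩
  set u := f - g with hu_def
  have hgc : Continuous g := hg.continuous
  have huc : Continuous u := hfc.sub hgc
  have hu : HasWeakDeriv u (weakDeriv u) := by
    obtain ⟨-, G, hG, -⟩ := hf
    exact hasWeakDeriv_weakDeriv ⟨_, hG.sub (hasWeakDeriv_sphDeriv hg)⟩
  have hmem : ∀ p : Sph n × ℝ, 0 ≤ p.2 → ‖(1 + p.2) • (p.1 : Euc (n + 1))‖ = 1 + p.2 := fun p hp =>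
    norm_smul_sph (by linarith) p.1
  let S : Set (Euc (n + 1)) := {y | 1 ≤ ‖y‖ ∧ ‖y‖ < 2}
  let Ω : Set (Euc (n + 1)) := {y | y ≠ 0 ∧ ‖y‖ < 2}
  have hΩ : IsOpen Ω :=
    isOpen_compl_singleton.inter (isOpen_lt continuous_norm continuous_const)
  have hS : MeasurableSet S :=
    (measurableSet_le measurable_const measurable_norm).inter
      (measurableSet_lt measurable_norm measurable_const)
  have hSΩ : S ⊆ Ω := fun y hy => ⟨norm_pos_iff.1 (by linarith [hy.1]), hy.2⟩
  have hvol : volume S ≠ ⊤ :=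
    ((measure_mono fun y hy => by simpa using hy.2.le).trans_lt
      (isCompact_closedBall (0 : Euc (n + 1)) 2).measure_lt_top).ne
  have hF : ContDiffOn ℝ ∞ (shellMap g u) Ω := fun y hy =>
    (contDiffAt_shellMap hg hu.integrable hy.1 hy.2).contDiffWithinAt
  refine ⟨fun p => shellMap g u ((1 + p.2) • (p.1 : Euc (n + 1))), ?_, ?_, fun x => ?_, fun x => ?_,
    ?_⟩
  · refine (continuousOn_shellMap hgc huc).comp (by fun_prop) fun p hp => ?_
    have h2 := hp.2
    exact ⟨by rw [hmem p h2.1]; linarith [h2.1], by rw [hmem p h2.1]; linarith [h2.2]⟩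
  · have : Fact (Module.finrank ℝ (Euc (n + 1)) = n + 1) := ⟨finrank_euc n⟩
    have hmap : ContMDiff ((𝓡 n).prod 𝓘(ℝ, ℝ)) 𝓘(ℝ, Euc (n + 1)) ∞
        fun p : Sph n × ℝ => (1 + p.2) • (p.1 : Euc (n + 1)) :=
      (contMDiff_const.add contMDiff_snd).smul (contMDiff_coe_sphere.comp contMDiff_fst)
    refine hF.contMDiffOn.comp hmap.contMDiffOn fun p hp => ?_
    have h2 := hp.2
    exact ⟨smul_sph_ne_zero (by linarith [h2.1]) _, by rw [hmem p h2.1]; linarith [h2.2]⟩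
  · simpa using shellMap_sph g u x
  · have : (1 : ℝ) + 1 = 2 := by norm_num
    simp only [this]
    rw [shellMap_two_smul]
    simp [u]
  · -- the image of the homotopy is the image of the shell
    have himg : (fun p : Sph n × ℝ => shellMap g u ((1 + p.2) • (p.1 : Euc (n + 1)))) ''
        (univ ×ˢ Ico (0 : ℝ) 1) ⊆ shellMap g u '' S := by
      rintro _ ⟨p, hp, rfl⟩
      have h2 := hp.2
      exact ⟨_, ⟨by rw [hmem p h2.1]; linarith [h2.1], by rw [hmem p h2.1]; linarith [h2.2]⟩, rfl⟩
    have harea := hκ (shellMap g u) Ω S (fun y => (rdir y : Euc (n + 1))) hΩ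
      (hF.of_le (by simp)) (continuous_subtype_val.comp_continuousOn
        (continuousOn_rdir.mono fun y hy => hy.1)) (fun y _ => norm_sph _) hSΩ hS hvol
    let h : Sph n → ℝ≥0∞ := fun x => ‖u x‖ₑ + ‖weakDeriv u x‖ₑ
    have hh : AEMeasurable h (surf n) :=
      hu.integrable.aestronglyMeasurable.enorm.add hu.integrable_deriv.aestronglyMeasurable.enorm
    let A : Euc (n + 1) → ℝ≥0∞ := fun y => localAvg h y
    have hAm : Measurable A := by
      simp only [A]
      rw [localAvg_congr hh.ae_eq_mk]
      exact measurable_localAvg hh.measurable_mk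
    let γ : Sph n → ℝ≥0∞ := fun x => ‖sphDeriv g x‖ₑ
    have hγ : Measurable γ := (continuous_sphDeriv hg).measurable.enorm
    set w := w1Norm (n : ℝ≥0) u with hw
    set Γ := eLpNorm (fun x => hsNorm (sphDeriv g x)) (n + 1 : ℝ≥0∞) (surf n) with hΓ
    -- the size of `u`
    have hA : (∫⁻ y in S, (5 * A y) ^ (n + 1)) ^ (1 / (n + 1 : ℝ)) ≤ 10 * c₁ * w := by
      have h1 := hC₁ (hh.mk h) hh.measurable_mk
      rw [← localAvg_congr hh.ae_eq_mk] at h1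
      have h2 : ∫⁻ x, hh.mk h x ^ n ∂(surf n) = ∫⁻ x, h x ^ n ∂(surf n) := by
        refine lintegral_congr_ae ?_
        filter_upwards [hh.ae_eq_mk] with x hx
        rw [← hx]
      rw [h2] at h1
      have h3 := lintegral_enorm_add_le_w1Norm hn u
      have hpow : ∀ z : ℝ≥0∞, (z ^ (n + 1)) ^ (1 / (n + 1 : ℝ)) = z := fun z => by
        rw [← ENNReal.rpow_natCast, ← ENNReal.rpow_mul]
        push_cast
        rw [mul_one_div_cancel (by positivity), ENNReal.rpow_one]
      simp_rw [mul_pow]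
      rw [lintegral_const_mul' _ _ (by finiteness)]
      calc (5 ^ (n + 1) * ∫⁻ y in S, A y ^ (n + 1)) ^ (1 / (n + 1 : ℝ))
          ≤ (5 ^ (n + 1) * (C₁ * (2 * w) ^ (n + 1))) ^ (1 / (n + 1 : ℝ)) := by
            gcongr
            refine h1.trans ?_
            gcongr
        _ = 5 * (c₁ * (2 * w)) := by
            rw [ENNReal.mul_rpow_of_nonneg _ _ (by positivity),
              ENNReal.mul_rpow_of_nonneg _ _ (by positivity), hpow, hpow,
              ENNReal.coe_rpow_of_nonneg _ (by positivity)]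
        _ = 10 * c₁ * w := by ring
    -- the size of `Dg`
    have hG : (∫⁻ y in S, γ (rdir y) ^ (n + 1)) ^ (1 / (n + 1 : ℝ)) ≤ 2 * Γ := by
      refine (lintegral_shell_comp_rdir_le hγ).trans ?_
      gcongr
      have hp : (n + 1 : ℝ≥0∞).toReal = (n + 1 : ℝ) := by
        rw [show (n + 1 : ℝ≥0∞) = ((n + 1 : ℕ) : ℝ≥0∞) by push_cast; rfl, ENNReal.toReal_natCast]
        push_cast; rfl
      rw [hΓ, eLpNorm_eq_lintegral_rpow_enorm_toReal (by positivity) (by finiteness), hp]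
      gcongr with x
      rw [← ENNReal.rpow_natCast]
      push_cast
      gcongr
      refine (enorm_le_ofReal_hsNorm _).trans (le_of_eq ?_)
      exact (Real.enorm_of_nonneg (Real.sqrt_nonneg _)).symm
    calc _ ≤ μH[(n + 1 : ℝ)] (shellMap g u '' S) := measure_mono himg
      _ ≤ κ * ∫⁻ y in S, 5 * A y * (γ (rdir y) + 5 * A y) ^ n := by
          refine harea.trans ?_
          refine mul_le_mul_right (setLIntegral_mono' hS fun y hy => ?_) _
          have h1 := enorm_fderiv_shellMap_le hg hu hy.1 hy.2
          exact mul_le_mul' h1.1 (pow_le_pow_left' h1.2 n)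
      _ ≤ κ * (10 * c₁ * w * (2 * Γ + 10 * c₁ * w) ^ n) := by
          refine mul_le_mul_right ((lintegral_mul_add_pow_le (hAm.const_mul 5)
            (hγ.comp measurable_rdir) n hn0).trans ?_) _
          exact mul_le_mul' hA (pow_le_pow_left' (add_le_add hG hA) n)
      _ ≤ κ * (10 * c₁ * w * ((2 + 10 * c₁) * (w + Γ)) ^ n) := by
          gcongr
          calc 2 * Γ + 10 * c₁ * w ≤ (2 * Γ + 10 * c₁ * w) + (2 * w + 10 * c₁ * Γ) := le_self_add
            _ = _ := by ring
      _ = _ := by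
          push_cast
          rw [mul_pow]
          ring
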